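/- **Proposition 5.7.** Let $-1<a<0$, $s=\frac{1-a}{2}\in(\tfrac12,1)$ and $\Omega=(-1,1)\times(0,1)$, with points $(x,y)$. Let $W^{1,2}(\Omega,y^a)$ be the closure of $C^\infty(\overline\Omega)$ in the norm $\big(\int_\Omega|u|^2y^a+\int_\Omega|\nabla u|^2y^a\big)^{1/2}$, and for $u$ in this space let $Tu$ be its trace on $(-1,1)\times\{0\}$, i.e. the continuous extension of $u\mapsto u(\cdot,0)$ from $C^\infty(\overline\Omega)$. Write $$[v]^2_{H^s}=\int_{(-1,1)^2}\frac{|v(x)-v(x')|^2}{|x-x'|^{1+2s}}\,dx\,dx',\qquad D_s=\frac{d_s}{e_s},\qquad d_s=\int_{\mathbb R}\frac{2-2\cos z}{|z|^{1+2s}}\,dz,$$ $$e_s=\inf\Big\{\int_0^\infty\big(\varphi'(t)^2+\varphi(t)^2\big)t^a\,dt:\ \varphi(0)=1,\ \lim_{t\to\infty}\varphi(t)=0\Big\},$$ the infimum being over $\varphi$ of finite energy that are continuous on $[0,\infty)$ and differentiable on $(0,\infty)$. For $\epsilon>0$ put $\Lambda_\epsilon=\epsilon^{\frac{1-a}{-a}}$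 and let $v_\epsilon$ be the function on $(-1,1)$ with $v_\epsilon(x)=0$ for $x\le-\Lambda_\epsilon/2$, $v_\epsilon(x)=1$ for $x\ge\Lambda_\epsilon/2$, and $v_\epsilon(x)=\frac{x}{\Lambda_\epsilon}+\frac12$ in between. Then for each $\epsilon>0$ we have $v_\epsilon\in H^s(-1,1)$ and there is a function $u_\epsilon\in W^{1,2}(\Omega,y^a)$ with $Tu_\epsilon=v_\epsilon$ (so its trace makes the transition from $0$ to $1$ on a layer of width $\Lambda_\epsilon$), such that $$\epsilon^{1-a}\int_\Omega|\nabla u_\epsilon|^2y^a\,dx\,dy=D_s^{-1}\,\epsilon^{1-a}\,[Tu_\epsilon]^2_{H^s}+R_\epsilon,\qquad \lim_{\epsilon\to0^+}R_\epsilon=0,$$ and $R_\epsilon$ is of lower order: it is $o$ of the left-hand side and $o$ of the first term on the right-hand side as $\epsilon\to0^+$. In particular the constant $D_s$ in the trace inequality $[Tu]^2_{H^s}\le D_s\int_\Omega|\nabla u|^2y^a$ is asymptotically optimal: $$\lim_{\epsilon\to0^+}\frac{[Tu_\epsilon]^2_{H^s}}{\int_\Omega|\nabla u_\epsilon|^2y^a\,dx\,dy}=D_s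 .$$ -/

import Mathlib

open MeasureTheory Set Filter Topology Asymptotics
open scoped ContDiff

noncomputable section

namespace FractionalTrace

/-- The rectangle `Ω = (-1,1) × (0,1)`; a point is `p = (x, y)`. -/
def Omega : Set (ℝ × ℝ) := Ioo (-1 : ℝ) 1 ×ˢ Ioo (0 : ℝ) 1

/-- The measure `y^a dx dy` on `Ω`. -/
def weightedMeasure (a : ℝ) : Measure (ℝ × ℝ) :=
  (volume.restrict Omega).withDensity (fun p => ENNReal.ofReal (p.2 ^ a))

/-- The functions `f n ∈ C^∞(Ω̄)` (restrictions of smooth functions on the plane) converge to `u`,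
and their gradients to `(gx, gy)`, in `L²(Ω, y^a dx dy)`. -/
structure SmoothApprox (a : ℝ) (f : ℕ → ℝ × ℝ → ℝ) (u gx gy : ℝ × ℝ → ℝ) : Prop where
  smooth : ∀ n, ContDiff ℝ ∞ (f n)
  tendsto_fun : Tendsto (fun n => eLpNorm (fun p => f n p - u p) 2 (weightedMeasure a))
    atTop (𝓝 0)
  tendsto_dx : Tendsto
    (fun n => eLpNorm (fun p => fderiv ℝ (f n) p (1, 0) - gx p) 2 (weightedMeasure a))
    atTop (𝓝 0)
  tendsto_dy : Tendsto
    (fun n => eLpNorm (fun p => fderiv ℝ (f n) p (0, 1) - gy p) 2 (weightedMeasure a))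
    atTop (𝓝 0)

/-- `u` belongs to the weighted Sobolev space `W^{1,2}(Ω, y^a)`, the closure of `C^∞(Ω̄)` in the
norm `∫_Ω |u|² y^a + ∫_Ω |∇u|² y^a`, and `(gx, gy)` is its gradient. -/
structure MemW12 (a : ℝ) (u gx gy : ℝ × ℝ → ℝ) : Prop where
  memLp_fun : MemLp u 2 (weightedMeasure a)
  memLp_dx : MemLp gx 2 (weightedMeasure a)
  memLp_dy : MemLp gy 2 (weightedMeasure a)
  approx : ∃ f : ℕ → ℝ × ℝ → ℝ, SmoothApprox a f u gx gy

/-- `v` belongs to `H^s(-1,1)`. -/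
structure MemHs (s : ℝ) (v : ℝ → ℝ) : Prop where
  memLp : MemLp v 2 (volume.restrict (Ioo (-1 : ℝ) 1))
  integrable : IntegrableOn (fun q : ℝ × ℝ => |v q.1 - v q.2| ^ 2 / |q.1 - q.2| ^ (1 + 2 * s))
    (Ioo (-1 : ℝ) 1 ×ˢ Ioo (-1 : ℝ) 1)

/-- `v = Tu` is the trace on `(-1,1) × {0}` of `u ∈ W^{1,2}(Ω, y^a)` with gradient `(gx, gy)`:
`T` is the continuous extension of the restriction `f ↦ f(·, 0)` from `C^∞(Ω̄)` to
`W^{1,2}(Ω, y^a)`. -/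
def IsTrace (a : ℝ) (u gx gy : ℝ × ℝ → ℝ) (v : ℝ → ℝ) : Prop :=
  ∃ f : ℕ → ℝ × ℝ → ℝ, SmoothApprox a f u gx gy ∧
    Tendsto (fun n => eLpNorm (fun x => f n (x, 0) - v x) 2 (volume.restrict (Ioo (-1 : ℝ) 1)))
      atTop (𝓝 0)

/-- `∫_Ω |∇u|² y^a dx dy` for a function with gradient `(gx, gy)`. -/
def weightedEnergy (a : ℝ) (gx gy : ℝ × ℝ → ℝ) : ℝ :=
  ∫ p in Omega, (gx p ^ 2 + gy p ^ 2) * p.2 ^ a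

/-- The squared seminorm `∫_{(-1,1)²} |v(x) - v(x')|² / |x - x'|^{1+2s} dx dx'` of `H^s(-1,1)`. -/
def gagliardoSq (s : ℝ) (v : ℝ → ℝ) : ℝ :=
  ∫ q in Ioo (-1 : ℝ) 1 ×ˢ Ioo (-1 : ℝ) 1, |v q.1 - v q.2| ^ 2 / |q.1 - q.2| ^ (1 + 2 * s)

/-- `d_s = ∫_ℝ (2 - 2 cos z) / |z|^{1+2s} dz`. -/
def dConst (s : ℝ) : ℝ := ∫ z : ℝ, (2 - 2 * Real.cos z) / |z| ^ (1 + 2 * s)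

/-- The values `∫_0^∞ (φ'(t)² + φ(t)²) t^{1-2s} dt` of the one-dimensional functional, over the
profiles `φ` on `[0, ∞)` of finite energy with `φ(0) = 1` and `φ(t) → 0` as `t → ∞`. -/
def profileEnergies (s : ℝ) : Set ℝ :=
  {E | ∃ φ φ' : ℝ → ℝ, ContinuousOn φ (Ici 0) ∧ (∀ t, 0 < t → HasDerivAt φ (φ' t) t) ∧
    φ 0 = 1 ∧ Tendsto φ atTop (𝓝 0) ∧
    IntegrableOn (fun t => (φ' t ^ 2 + φ t ^ 2) * t ^ (1 - 2 * s)) (Ioi 0) ∧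
    E = ∫ t in Ioi (0 : ℝ), (φ' t ^ 2 + φ t ^ 2) * t ^ (1 - 2 * s)}

/-- The minimal energy of the one-dimensional profile problem. With the Fourier transform
`v̂(ξ) = ∫ v(x) e^{-2πixξ} dx`, the minimal energy of an extension of `v` to the half-plane is
`(2π)^{2s} (profileMin s) ∫ |v̂(ξ)|² |ξ|^{2s} dξ`. -/
def profileMin (s : ℝ) : ℝ := sInf (profileEnergies s)

/-- The sharp constant of the trace inequality in the half-plane,
`D_s = d_s (2π)^{2s} / ((2π)^{2s} profileMin s)`; for `s = 1/2` it would be `2π`. -/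
def DConst (s : ℝ) : ℝ := dConst s / profileMin s

/-- The width `Λ_ε = ε^{(1-a)/(-a)}` of the transition layer. -/
def layerWidth (a ε : ℝ) : ℝ := ε ^ ((1 - a) / (-a))

/-- The transition `v_ε`: it is `0` for `x ≤ -Λ_ε/2`, it is `1` for `x ≥ Λ_ε/2`, and it is affine
in between. -/
def layerProfile (a ε : ℝ) (x : ℝ) : ℝ := max 0 (min 1 (x / layerWidth a ε + 1 / 2))

end FractionalTrace

end

/-! Both energies of a transition from 0 to 1 become multiples of a single spectral quantity, and
the ratio of the multiples can be brought as close to the sharp constant as desired.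

Extend `v` by `u(x,y) = ∫ K(z) v(x - y z) dz` and put `w = v'`. Then `∂ₓu` and `∂ᵧu` are, up to
sign, the same construction applied to `w` with the kernels `K` and `z K(z)`. If `K` has symbol
`ψ(2πξ)` with `ψ` even, Plancherel at each height `y` and the substitution `t = |2πξ| y` give the
half-plane energy `E(ψ) J`, where `E(ψ) = ∫_0^∞ (ψ'² + ψ²) t^a dt` and `J = ∫ |ŵ(ξ)|² |2πξ|^{2s-2}
dξ`. Plancherel for the increments of `v` gives `d_s J` for the Gagliardo double integral over the
plane (`lintegral_energy_kernelExt`, `lintegral_gagliardoIntegrand_ramp`). Working with `w` is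
essential, because a transition from 0 to 1 is not in `L²` of the line; `s > 1/2` makes `J` finite
at low frequencies.

Under dilation by `Λ` both energies scale like `Λ^a`, and `Λ_ε` is the width for which `ε^{1-a}
Λ_ε^a = 1`. The rescaled integrals are therefore integrals of fixed integrable functions over
dilated domains that exhaust the half-plane and the plane, and they converge to `E(ψ) J` and `d_s J`
(`tendsto_setIntegral_dilation`).

The infimum `e_s` need not be attained by a profile with a nice kernel, but smooth, even, compactly
supported profiles come arbitrarily close to it (`exists_smoothProfile_energy_lt`), and each is the
symbol of a real kernel with all moments (`SmoothProfile.exists_kernel`). A kernel depending on `ε`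
(`exists_diagonal`) brings the extension energy to `e_s J = D_s⁻¹ d_s J`. Both sides then share a
nonzero limit (`profileMin_pos`, `spectralEnergy_pos`), so their difference is of lower order. -/

open scoped FourierTransform ENNReal Pointwise

namespace FractionalTrace

/-! ### Plancherel's theorem for convolutions -/

/-- On `L¹ ∩ L²` the `L²` Fourier transform is given by the Fourier integral. -/
theorem fourier_toLp_ae_eq {f : ℝ → ℂ} (h1 : Integrable f) (h2 : MemLp f 2) :
    (𝓕 (h2.toLp f) : Lp ℂ 2 (volume : Measure ℝ)) =ᵐ[volume] 𝓕 f := by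
  have hF : Continuous (𝓕 f) :=
    VectorFourier.fourierIntegral_continuous Real.continuous_fourierChar continuous_inner h1
  refine ae_eq_of_integral_contDiff_smul_eq
    ((Lp.memLp (𝓕 (h2.toLp f))).locallyIntegrable one_le_two) hF.locallyIntegrable ?_
  -- The two transforms agree as tempered distributions: tested against `g`, each transfers the
  -- Fourier transform to `g`.
  intro g hg hc
  have hgc : ContDiff ℝ ∞ (fun x => (g x : ℂ)) := Complex.ofRealCLM.contDiff.comp hg
  have hcc : HasCompactSupport (fun x => (g x : ℂ)) := hc.comp_left (g := fun r : ℝ => (r : ℂ)) rfl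
  set G := hcc.toSchwartzMap hgc with hG
  have key := congrArg (fun T => T G) (Lp.fourier_toTemperedDistribution_eq (h2.toLp f))
  simp only [TemperedDistribution.fourier_apply, Lp.toTemperedDistribution_apply] at key
  have h3 : ∀ x, g x • (𝓕 f) x = G x • (𝓕 f) x := fun x => by simp [hG]
  have h4 : ∀ x, g x • ((𝓕 (h2.toLp f) : Lp ℂ 2 (volume : Measure ℝ)) : ℝ → ℂ) x
     = G x • ((𝓕 (h2.toLp f) : Lp ℂ 2 (volume : Measure ℝ)) : ℝ → ℂ) x := fun x => by simp [hG]
  simp only [h3, h4]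
  rw [← key]
  have h5 : ∫ ξ, 𝓕 (G : ℝ → ℂ) ξ • f ξ = ∫ x, G x • 𝓕 f x := by
    simpa using! VectorFourier.integral_bilin_fourierIntegral_eq_flip (.lsmul ℂ ℂ) (L := innerₗ ℝ)
      Real.continuous_fourierChar continuous_inner G.integrable h1
  rw [← h5]
  refine integral_congr_ae ?_
  filter_upwards [h2.coeFn_toLp] with x hx
  rw [hx, SchwartzMap.fourier_coe]

/-- Plancherel's theorem for functions in `L¹ ∩ L²`. -/
theorem lintegral_enorm_fourier_sq {f : ℝ → ℂ} (h1 : Integrable f) (h2 : MemLp f 2) :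
    ∫⁻ ξ, ‖𝓕 f ξ‖ₑ ^ 2 = ∫⁻ x, ‖f x‖ₑ ^ 2 := by
  have h := Lp.norm_fourier_eq (h2.toLp f)
  rw [Lp.norm_def, Lp.norm_def, eLpNorm_congr_ae (fourier_toLp_ae_eq h1 h2),
    eLpNorm_congr_ae h2.coeFn_toLp] at h
  have hfin : eLpNorm (𝓕 f) 2 volume ≠ ⊤ := by
    rw [← eLpNorm_congr_ae (fourier_toLp_ae_eq h1 h2)]
    exact Lp.eLpNorm_ne_top _
  have h' := (ENNReal.toReal_eq_toReal_iff' hfin h2.eLpNorm_ne_top).1 h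
  have e := congrArg (fun t => t ^ (2 : ℕ)) h'
  have key : ∀ g : ℝ → ℂ, eLpNorm g 2 volume ^ (2 : ℕ) = ∫⁻ x, ‖g x‖ₑ ^ 2 := fun g => by
    have := eLpNorm_nnreal_pow_eq_lintegral (p := 2) (f := g) (μ := (volume : Measure ℝ)) (by simp)
    simpa using this
  simpa only [key] using e

/-- The Fourier transform of a real function. -/
noncomputable def realFourier (f : ℝ → ℝ) : ℝ → ℂ := 𝓕 (fun x => (f x : ℂ))

theorem realFourier_continuous {f : ℝ → ℝ} (h : Integrable f) : Continuous (realFourier f) :=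
  VectorFourier.fourierIntegral_continuous Real.continuous_fourierChar continuous_inner h.ofReal

theorem integrable_mul_comp_sub {k w : ℝ → ℝ} (hk : Integrable k) (hw : Measurable w) {C : ℝ}
    (hC : ∀ x, |w x| ≤ C) (x y : ℝ) : Integrable (fun z => k z * w (x - y * z)) :=
  hk.mul_bdd (c := C) (hw.comp (by fun_prop)).aestronglyMeasurable (.of_forall fun z => hC _)

/-- Plancherel's theorem for a convolution of an `L¹` function and a bounded `L¹` function. -/
theorem lintegral_enorm_convolution_sq {k w : ℝ → ℝ} (hk : Integrable k) (hw : Integrable w)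
    {C : ℝ} (hC : ∀ x, |w x| ≤ C) :
    ∫⁻ x, ‖∫ z, k z * w (x - z)‖ₑ ^ 2 = ∫⁻ ξ, ‖realFourier k ξ‖ₑ ^ 2 * ‖realFourier w ξ‖ₑ ^ 2 := by
  set kc : ℝ → ℂ := fun x => (k x : ℂ)
  set wc : ℝ → ℂ := fun x => (w x : ℂ)
  have hkc : Integrable kc := hk.ofReal
  have hwc : Integrable wc := hw.ofReal
  set g := convolution kc wc (ContinuousLinearMap.mul ℂ ℂ) with hg
  have hgx : ∀ x, g x = ((∫ z, k z * w (x - z) : ℝ) : ℂ) := fun x => by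
    rw [← integral_complex_ofReal]
    simp [hg, convolution, kc, wc]
  have hg1 : Integrable g := hkc.integrable_convolution _ hwc
  have hgb : ∀ x, ‖g x‖ ≤ (∫ z, |k z|) * C := fun x => by
    rw [hgx, Complex.norm_real, ← integral_mul_const]
    refine norm_integral_le_of_norm_le (hk.abs.mul_const C) (.of_forall fun z => ?_)
    rw [norm_mul]
    exact mul_le_mul_of_nonneg_left (hC _) (abs_nonneg _)
  -- A bounded integrable function is square integrable.
  have hg2 : MemLp g 2 := by
    rw [memLp_two_iff_integrable_sq_norm hg1.aestronglyMeasurable]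
    simp_rw [pow_two]
    exact hg1.norm.mul_bdd hg1.norm.aestronglyMeasurable
      (.of_forall fun x => by rw [norm_norm]; exact hgb x)
  have h := lintegral_enorm_fourier_sq hg1 hg2
  have h1 : ∀ ξ, ‖𝓕 g ξ‖ₑ ^ 2 = ‖realFourier k ξ‖ₑ ^ 2 * ‖realFourier w ξ‖ₑ ^ 2 := fun ξ => by
    rw [hg, Real.fourier_mul_convolution_eq hkc hwc, enorm_mul, mul_pow]
    rfl
  have h2 : ∀ x, ‖g x‖ₑ = ‖∫ z, k z * w (x - z)‖ₑ := fun x => by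
    rw [hgx, ← ofReal_norm, ← ofReal_norm, Complex.norm_real]
  simp_rw [h1, h2] at h
  exact h.symm

theorem realFourier_dilation (k : ℝ → ℝ) {y : ℝ} (hy : 0 < y) (ξ : ℝ) :
    realFourier (fun z => y⁻¹ * k (y⁻¹ * z)) ξ = realFourier k (y * ξ) := by
  unfold realFourier
  rw [Real.fourier_real_eq, Real.fourier_real_eq]
  have h := Measure.integral_comp_mul_left
    (fun v : ℝ => Real.fourierChar (-(v * (y * ξ))) • (k v : ℂ)) y⁻¹
  rw [inv_inv, abs_of_pos hy] at h
  have hy' : (y : ℂ) ≠ 0 := by exact_mod_cast hy.ne'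
  have h2 : ∀ z, Real.fourierChar (-(z * ξ)) • ((y⁻¹ * k (y⁻¹ * z) : ℝ) : ℂ) =
      y⁻¹ • (Real.fourierChar (-(y⁻¹ * z * (y * ξ))) • (k (y⁻¹ * z) : ℂ)) := fun z => by
    have : y⁻¹ * z * (y * ξ) = z * ξ := by field_simp
    rw [this]
    simp only [Circle.smul_def, Complex.real_smul, smul_eq_mul]
    push_cast
    ring
  simp_rw [h2]
  rw [integral_smul, h, smul_smul, inv_mul_cancel₀ hy.ne', one_smul]

/-- At height `y` the extension is the convolution with `y⁻¹ k(·/y)`, whose symbol is that of `k`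
dilated by `y`. -/
theorem lintegral_enorm_dilated_convolution_sq {k w : ℝ → ℝ} (hk : Integrable k)
    (hw : Integrable w) {C : ℝ} (hC : ∀ x, |w x| ≤ C) {y : ℝ} (hy : 0 < y) :
    ∫⁻ x, ‖∫ z, k z * w (x - y * z)‖ₑ ^ 2 =
      ∫⁻ ξ, ‖realFourier k (y * ξ)‖ₑ ^ 2 * ‖realFourier w ξ‖ₑ ^ 2 := by
  have hk' : Integrable (fun z => y⁻¹ * k (y⁻¹ * z)) :=
    (hk.comp_mul_left' (inv_ne_zero hy.ne')).const_mul _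
  have h := lintegral_enorm_convolution_sq hk' hw hC
  simp_rw [realFourier_dilation k hy] at h
  rw [← h]
  refine lintegral_congr fun x => ?_
  have h1 := Measure.integral_comp_mul_left (fun z => k z * w (x - y * z)) y⁻¹
  rw [inv_inv, abs_of_pos hy, smul_eq_mul] at h1
  have h2 : ∀ z, y⁻¹ * k (y⁻¹ * z) * w (x - z) =
      y⁻¹ * (k (y⁻¹ * z) * w (x - y * (y⁻¹ * z))) := fun z => by
    rw [mul_inv_cancel_left₀ hy.ne', mul_assoc]
  simp_rw [h2]
  rw [integral_const_mul, h1, inv_mul_cancel_left₀ hy.ne']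

/-! ### Kernel extensions: smoothness and weighted `L²` bounds -/

/-- The kernel `K` has integrable moments of all orders. -/
def HasMoments (K : ℝ → ℝ) : Prop := ∀ n : ℕ, Integrable (fun z => z ^ n * K z)

theorem HasMoments.integrable {K : ℝ → ℝ} (h : HasMoments K) : Integrable K := by
  simpa using h 0

theorem HasMoments.id_mul {K : ℝ → ℝ} (h : HasMoments K) : HasMoments (fun z => z * K z) :=
  fun n => by simpa [pow_succ, mul_assoc] using h (n + 1)

/-- Smooth functions all of whose derivatives are bounded. -/
def BddDerivs (v : ℝ → ℝ) : Prop :=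
  ContDiff ℝ ∞ v ∧ ∀ n : ℕ, ∃ C, ∀ x, |iteratedDeriv n v x| ≤ C

theorem BddDerivs.deriv {v : ℝ → ℝ} (h : BddDerivs v) : BddDerivs (deriv v) :=
  ⟨((contDiff_infty_iff_deriv (𝕜 := ℝ)).1 h.1).2, fun n => by
    simpa [iteratedDeriv_succ'] using h.2 (n + 1)⟩

theorem BddDerivs.bound {v : ℝ → ℝ} (h : BddDerivs v) : ∃ C, ∀ x, |v x| ≤ C := by
  simpa using h.2 0

/-- The extension `∫ K(z) v(x - y z) dz` of `v` to the plane with kernel `K`. -/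
noncomputable def kernelExt (K v : ℝ → ℝ) (p : ℝ × ℝ) : ℝ := ∫ z, K z * v (p.1 - p.2 * z)

/-- The derivative falls on `v` rather than on `K`, so each height derivative costs a moment of `K`
instead of a factor `1/y`. Both partial derivatives are again kernel extensions, which lets
smoothness up to `y = 0` follow by induction. -/
theorem hasFDerivAt_kernelExt {K v : ℝ → ℝ} (hK : HasMoments K) (hv : BddDerivs v) (p : ℝ × ℝ) :
    HasFDerivAt (kernelExt K v)
      (kernelExt K (deriv v) p • ContinuousLinearMap.fst ℝ ℝ ℝ -
        kernelExt (fun z => z * K z) (deriv v) p • ContinuousLinearMap.snd ℝ ℝ ℝ) p := by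
  obtain ⟨C₀, hC₀⟩ := hv.bound
  obtain ⟨C, hC⟩ := hv.deriv.bound
  have hvc : Continuous v := hv.1.continuous
  have hdc : Continuous (deriv v) := hv.deriv.1.continuous
  have hi : ∀ q : ℝ × ℝ, Integrable (fun z => K z * v (q.1 - q.2 * z)) := fun q =>
    integrable_mul_comp_sub hK.integrable hvc.measurable hC₀ _ _
  have hi1 : Integrable (fun z => K z * deriv v (p.1 - p.2 * z)) :=
    integrable_mul_comp_sub hK.integrable hdc.measurable hC _ _
  have hi2 : Integrable (fun z => z * K z * deriv v (p.1 - p.2 * z)) :=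
    integrable_mul_comp_sub hK.id_mul.integrable hdc.measurable hC _ _
  let A := ContinuousLinearMap.fst ℝ ℝ ℝ
  let B := ContinuousLinearMap.snd ℝ ℝ ℝ
  have key := hasFDerivAt_integral_of_dominated_of_fderiv_le (μ := (volume : Measure ℝ))
    (F := fun q z => K z * v (q.1 - q.2 * z))
    (F' := fun q z => (K z * deriv v (q.1 - q.2 * z)) • A -
      (z * K z * deriv v (q.1 - q.2 * z)) • B)
    (bound := fun z => ‖K z‖ * C + ‖z * K z‖ * C) (x₀ := p) (s := univ) univ_mem
    (.of_forall fun q => (hi q).aestronglyMeasurable) (hi p)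
    ((hi1.smul_const A).sub (hi2.smul_const B)).aestronglyMeasurable
    (.of_forall fun z q _ => ?_) ?_ (.of_forall fun z q _ => ?_)
  · rw [integral_sub (hi1.smul_const A) (hi2.smul_const B), integral_smul_const,
      integral_smul_const] at key
    exact key
  · refine (norm_sub_le _ _).trans (add_le_add ?_ ?_)
    · rw [norm_smul, norm_mul]
      calc _ ≤ ‖K z‖ * C * 1 := by
            gcongr
            · exact mul_nonneg (norm_nonneg _) ((abs_nonneg _).trans (hC 0))
            · exact hC _
            · exact ContinuousLinearMap.norm_fst_le ℝ ℝ ℝ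
        _ = _ := mul_one _
    · rw [norm_smul, norm_mul]
      calc _ ≤ ‖z * K z‖ * C * 1 := by
            gcongr
            · exact mul_nonneg (norm_nonneg _) ((abs_nonneg _).trans (hC 0))
            · exact hC _
            · exact ContinuousLinearMap.norm_snd_le ℝ ℝ ℝ
        _ = _ := mul_one _
  · exact (hK.integrable.norm.mul_const C).add (hK.id_mul.integrable.norm.mul_const C)
  · have h1 : HasDerivAt v (deriv v (q.1 - q.2 * z)) (q.1 - q.2 * z) :=
      (hv.1.differentiable (by simp)).differentiableAt.hasDerivAt
    have h2 : HasFDerivAt (fun q : ℝ × ℝ => q.1 - q.2 * z) (A - z • B) q :=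
      A.hasFDerivAt.sub (B.hasFDerivAt.mul_const z)
    have h3 := (h1.comp_hasFDerivAt q h2).const_mul (K z)
    refine h3.congr_fderiv ?_
    rw [smul_sub, smul_sub, smul_smul, smul_smul, smul_smul]
    congr 2
    ring

theorem contDiff_kernelExt {K v : ℝ → ℝ} (hK : HasMoments K) (hv : BddDerivs v) :
    ContDiff ℝ ∞ (kernelExt K v) := by
  rw [contDiff_infty]
  intro n
  induction n generalizing K v with
  | zero =>
    exact contDiff_zero.2 (continuous_iff_continuousAt.2 fun p =>
      (hasFDerivAt_kernelExt hK hv p).continuousAt)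
  | succ n ih =>
    refine contDiff_succ_iff_hasFDerivAt.2 ⟨_, ?_, hasFDerivAt_kernelExt hK hv⟩
    exact ((ih hK hv.deriv).smul contDiff_const).sub ((ih hK.id_mul hv.deriv).smul contDiff_const)

theorem fderiv_kernelExt_fst {K v : ℝ → ℝ} (hK : HasMoments K) (hv : BddDerivs v) (p : ℝ × ℝ) :
    fderiv ℝ (kernelExt K v) p (1, 0) = kernelExt K (deriv v) p := by
  rw [(hasFDerivAt_kernelExt hK hv p).fderiv]; simp

theorem fderiv_kernelExt_snd {K v : ℝ → ℝ} (hK : HasMoments K) (hv : BddDerivs v) (p : ℝ × ℝ) :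
    fderiv ℝ (kernelExt K v) p (0, 1) = -kernelExt (fun z => z * K z) (deriv v) p := by
  rw [(hasFDerivAt_kernelExt hK hv p).fderiv]; simp

theorem measurable_kernelExt {K v : ℝ → ℝ} (hK : Measurable K) (hv : Measurable v) :
    Measurable (kernelExt K v) := by
  have : StronglyMeasurable (Function.uncurry fun (p : ℝ × ℝ) (z : ℝ) => K z * v (p.1 - p.2 * z)) := by
    apply Measurable.stronglyMeasurable
    simp only [Function.uncurry_def]
    fun_prop
  exact (this.integral_prod_right (ν := volume)).measurable

/-- Cauchy–Schwarz after writing `k = k^{1/2} k^{1/2}`. -/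
theorem sq_lintegral_mul_le {α : Type*} [MeasurableSpace α] (μ : Measure α) {k g : α → ℝ≥0∞}
    (hk : Measurable k) (hg : Measurable g) :
    (∫⁻ z, k z * g z ∂μ) ^ 2 ≤ (∫⁻ z, k z ∂μ) * ∫⁻ z, k z * g z ^ 2 ∂μ := by
  have h := ENNReal.lintegral_mul_le_Lp_mul_Lq μ Real.HolderConjugate.two_two
    (f := fun z => k z ^ (1 / 2 : ℝ)) (g := fun z => k z ^ (1 / 2 : ℝ) * g z)
    (by fun_prop) (by fun_prop)
  have h1 : ∀ z, (k z ^ (1 / 2 : ℝ)) ^ (2 : ℝ) = k z := fun z => by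
    rw [← ENNReal.rpow_mul]; norm_num
  have h2 : ∀ z, (k z ^ (1 / 2 : ℝ) * g z) ^ (2 : ℝ) = k z * g z ^ 2 := fun z => by
    rw [ENNReal.mul_rpow_of_nonneg _ _ zero_le_two, h1, ENNReal.rpow_two]
  have h3 : ∀ z, ((fun z => k z ^ (1 / 2 : ℝ)) * fun z => k z ^ (1 / 2 : ℝ) * g z) z =
      k z * g z := fun z => by
    have : k z ^ (1 / 2 : ℝ) * k z ^ (1 / 2 : ℝ) = k z := by
      rw [← pow_two, ← ENNReal.rpow_two, h1]
    rw [Pi.mul_apply, ← mul_assoc, this]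
  simp_rw [h1, h2, h3] at h
  calc _ ≤ _ := pow_le_pow_left' h 2
    _ = _ := by
      rw [mul_pow, ← ENNReal.rpow_two, ← ENNReal.rpow_two, ← ENNReal.rpow_mul, ← ENNReal.rpow_mul]
      norm_num

/-- Young's inequality on a slice. The bound does not depend on `y`, since translations preserve the
`L²` norm. -/
theorem lintegral_kernelExt_sq_le {K g : ℝ → ℝ} (hK : Measurable K) (hg : Measurable g) (y : ℝ) :
    ∫⁻ x, ‖kernelExt K g (x, y)‖ₑ ^ 2 ≤ (∫⁻ z, ‖K z‖ₑ) ^ 2 * ∫⁻ x, ‖g x‖ₑ ^ 2 := by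
  calc ∫⁻ x, ‖kernelExt K g (x, y)‖ₑ ^ 2
      ≤ ∫⁻ x, (∫⁻ z, ‖K z‖ₑ) * ∫⁻ z, ‖K z‖ₑ * ‖g (x - y * z)‖ₑ ^ 2 := by
        refine lintegral_mono fun x => ?_
        refine le_trans ?_ (sq_lintegral_mul_le volume (by fun_prop) (by fun_prop))
        refine pow_le_pow_left' ((enorm_integral_le_lintegral_enorm _).trans_eq ?_) 2
        simp_rw [enorm_mul]
    _ = (∫⁻ z, ‖K z‖ₑ) * ∫⁻ z, ‖K z‖ₑ * ∫⁻ x, ‖g (x - y * z)‖ₑ ^ 2 := by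
        have hm : Measurable fun x => ∫⁻ z, ‖K z‖ₑ * ‖g (x - y * z)‖ₑ ^ 2 :=
          Measurable.lintegral_prod_right
            (f := fun x z => ‖K z‖ₑ * ‖g (x - y * z)‖ₑ ^ 2) (by fun_prop)
        rw [lintegral_const_mul _ hm, lintegral_lintegral_swap (by fun_prop)]
        congr 1
        refine lintegral_congr fun z => ?_
        rw [lintegral_const_mul _ (by fun_prop)]
    _ = _ := by
        simp_rw [lintegral_sub_right_eq_self (fun x => ‖g x‖ₑ ^ 2)]
        rw [lintegral_mul_const _ (by fun_prop), ← mul_assoc, pow_two]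

theorem lintegral_rpow_Ioo_lt_top {a : ℝ} (ha : -1 < a) (t : ℝ) :
    ∫⁻ y in Ioo 0 t, ENNReal.ofReal (y ^ a) < ⊤ := by
  rcases le_or_gt t 0 with ht | ht
  · simp [Ioo_eq_empty_of_le ht]
  · exact ((intervalIntegral.integrableOn_Ioo_rpow_iff ht).2 ha).lintegral_lt_top

theorem lintegral_weightedMeasure {a : ℝ} {f : ℝ × ℝ → ℝ≥0∞} (hf : Measurable f) :
    ∫⁻ p, f p ∂weightedMeasure a = ∫⁻ p in Omega, f p * ENNReal.ofReal (p.2 ^ a) := by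
  rw [weightedMeasure, lintegral_withDensity_eq_lintegral_mul _ (by fun_prop) hf]
  simp only [Pi.mul_apply, mul_comm]

theorem lintegral_prod_set {f : ℝ × ℝ → ℝ≥0∞} (hf : Measurable f) (s t : Set ℝ) :
    ∫⁻ p in s ×ˢ t, f p = ∫⁻ y in t, ∫⁻ x in s, f (x, y) := by
  rw [Measure.volume_eq_prod, ← Measure.prod_restrict, lintegral_prod_symm _ hf.aemeasurable]

theorem isFiniteMeasure_weightedMeasure {a : ℝ} (ha : -1 < a) :
    IsFiniteMeasure (weightedMeasure a) := by
  refine ⟨?_⟩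
  rw [← lintegral_one, lintegral_weightedMeasure measurable_const, Omega,
    lintegral_prod_set (by fun_prop)]
  simp only [one_mul, lintegral_const, Measure.restrict_apply_univ]
  rw [lintegral_mul_const _ (by fun_prop)]
  exact ENNReal.mul_lt_top (lintegral_rpow_Ioo_lt_top ha 1) (by simp)

/-- The slice bound is integrated against `y^a`, which is integrable on `(0,1)` because `a > -1`.
Convergence of derivatives in `L²` of the line thus passes to the gradients of the extensions. -/
theorem exists_eLpNorm_kernelExt_le {a : ℝ} (ha : -1 < a) {K : ℝ → ℝ} (hK : Measurable K)
    (hKi : Integrable K) : ∃ c : ℝ≥0∞, c ≠ ⊤ ∧ ∀ g : ℝ → ℝ, Measurable g →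
      eLpNorm (kernelExt K g) 2 (weightedMeasure a) ≤ c * eLpNorm g 2 volume := by
  set k := ∫⁻ z, ‖K z‖ₑ with hk
  set A := ∫⁻ y in Ioo (0 : ℝ) 1, ENNReal.ofReal (y ^ a) with hA
  have hkt : k ≠ ⊤ := hKi.2.ne
  have hAt : A ≠ ⊤ := (lintegral_rpow_Ioo_lt_top ha 1).ne
  refine ⟨(k ^ 2 * A) ^ (1 / 2 : ℝ), by finiteness, fun g hg => ?_⟩
  rw [eLpNorm_eq_lintegral_rpow_enorm_toReal (by simp) (by simp),
    eLpNorm_eq_lintegral_rpow_enorm_toReal (by simp) (by simp)]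
  simp only [ENNReal.toReal_ofNat, ENNReal.rpow_two]
  rw [← ENNReal.mul_rpow_of_nonneg _ _ (by norm_num)]
  refine ENNReal.rpow_le_rpow ?_ (by norm_num)
  have hm := measurable_kernelExt hK hg
  rw [lintegral_weightedMeasure (by fun_prop), Omega, lintegral_prod_set (by fun_prop)]
  calc _ ≤ ∫⁻ y in Ioo (0 : ℝ) 1, (k ^ 2 * ∫⁻ x, ‖g x‖ₑ ^ 2) * ENNReal.ofReal (y ^ a) := by
        refine lintegral_mono fun y => ?_
        refine (lintegral_mul_const (f := fun x => ‖kernelExt K g (x, y)‖ₑ ^ 2)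
          (ENNReal.ofReal (y ^ a)) (by fun_prop)).trans_le ?_
        gcongr
        exact (setLIntegral_le_lintegral _ _).trans (lintegral_kernelExt_sq_le hK hg y)
    _ = _ := by
        rw [lintegral_const_mul _ (by fun_prop)]
        ring

theorem kernelExt_sub {K f g : ℝ → ℝ} (hK : Integrable K) (hf : Measurable f) (hg : Measurable g)
    {C D : ℝ} (hC : ∀ x, |f x| ≤ C) (hD : ∀ x, |g x| ≤ D) (p : ℝ × ℝ) :
    kernelExt K f p - kernelExt K g p = kernelExt K (fun x => f x - g x) p := by
  rw [kernelExt, kernelExt, ← integral_sub (integrable_mul_comp_sub hK hf hC _ _)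
    (integrable_mul_comp_sub hK hg hD _ _)]
  simp only [kernelExt, mul_sub]

theorem abs_kernelExt_le {K f : ℝ → ℝ} (hK : Integrable K) {C : ℝ} (hC : ∀ x, |f x| ≤ C)
    (p : ℝ × ℝ) : |kernelExt K f p| ≤ (∫ z, |K z|) * C := by
  rw [← integral_mul_const]
  refine norm_integral_le_of_norm_le (f := fun z => K z * f (p.1 - p.2 * z))
    (hK.abs.mul_const C) (.of_forall fun z => ?_)
  rw [norm_mul]
  exact mul_le_mul_of_nonneg_left (hC _) (abs_nonneg _)

theorem tendsto_eLpNorm_kernelExt_sub {a : ℝ} (ha : -1 < a) {K w : ℝ → ℝ} {f : ℕ → ℝ → ℝ}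
    (hKm : Measurable K) (hK : Integrable K) (hw : Measurable w) (hf : ∀ n, BddDerivs (f n))
    {D : ℝ} (hD : ∀ x, |w x| ≤ D)
    (hlim : Tendsto (fun n => eLpNorm (fun x => f n x - w x) 2 volume) atTop (𝓝 0)) :
    Tendsto (fun n => eLpNorm (fun p => kernelExt K (f n) p - kernelExt K w p) 2
      (weightedMeasure a)) atTop (𝓝 0) := by
  obtain ⟨c, hc, hle⟩ := exists_eLpNorm_kernelExt_le ha hKm hK
  have h0 : Tendsto (fun n => c * eLpNorm (fun x => f n x - w x) 2 volume) atTop (𝓝 0) := by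
    simpa using ENNReal.Tendsto.const_mul hlim (Or.inr hc)
  refine tendsto_of_tendsto_of_tendsto_of_le_of_le tendsto_const_nhds h0 (fun _ => zero_le)
    fun n => ?_
  obtain ⟨C, hC⟩ := (hf n).bound
  have hfm : Measurable (f n) := (hf n).1.continuous.measurable
  simp_rw [kernelExt_sub hK hfm hw hC hD]
  exact hle _ (hfm.sub hw)

theorem tendsto_eLpNorm_of_unif {α : Type*} [MeasurableSpace α] {μ : Measure α}
    [IsFiniteMeasure μ] {F : ℕ → α → ℝ} {δ : ℕ → ℝ} (hδ : Tendsto δ atTop (𝓝 0))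
    (hF : ∀ n x, |F n x| ≤ δ n) : Tendsto (fun n => eLpNorm (F n) 2 μ) atTop (𝓝 0) := by
  have h0 : Tendsto (fun n => μ univ ^ (2 : ℝ≥0∞).toReal⁻¹ * ENNReal.ofReal (δ n)) atTop (𝓝 0) := by
    have := ENNReal.Tendsto.const_mul (a := μ univ ^ (2 : ℝ≥0∞).toReal⁻¹)
      (ENNReal.tendsto_ofReal hδ) (Or.inr (by finiteness))
    simpa using this
  refine tendsto_of_tendsto_of_tendsto_of_le_of_le tendsto_const_nhds h0 (fun _ => zero_le)
    fun n => ?_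
  exact eLpNorm_le_of_ae_bound (.of_forall fun x => hF n x)

/-! ### Membership in the weighted Sobolev space, and the trace -/

/-- `v` is a uniform limit of smooth functions whose derivatives converge to `w` in `L²`. -/
structure SmoothLimit (v w : ℝ → ℝ) : Prop where
  measurable_fun : Measurable v
  measurable_deriv : Measurable w
  bdd_fun : ∃ C, ∀ x, |v x| ≤ C
  bdd_deriv : ∃ C, ∀ x, |w x| ≤ C
  memLp : MemLp w 2 volume
  approx : ∃ (f : ℕ → ℝ → ℝ) (δ : ℕ → ℝ), (∀ n, BddDerivs (f n)) ∧ Tendsto δ atTop (𝓝 0) ∧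
    (∀ n x, |f n x - v x| ≤ δ n) ∧
    Tendsto (fun n => eLpNorm (fun x => deriv (f n) x - w x) 2 volume) atTop (𝓝 0)

/-- The extensions of the smooth approximants approximate the extension: their gradients converge by
the weighted `L²` bound, and the functions themselves converge uniformly, which suffices because the
weighted measure is finite. At `y = 0` the extension is `(∫ K) f = f`, so the same sequence gives
the trace. -/
theorem SmoothLimit.kernelExt_approx {a : ℝ} (ha : -1 < a) {K v w : ℝ → ℝ} (hKm : Measurable K)
    (hK : HasMoments K) (hK1 : ∫ z, K z = 1) (h : SmoothLimit v w) :
    MemW12 a (kernelExt K v) (kernelExt K w) (fun p => -kernelExt (fun z => z * K z) w p) ∧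
    IsTrace a (kernelExt K v) (kernelExt K w) (fun p => -kernelExt (fun z => z * K z) w p) v := by
  obtain ⟨f, δ, hf, hδ, hfv, hfw⟩ := h.approx
  obtain ⟨C, hC⟩ := h.bdd_fun
  obtain ⟨D, hD⟩ := h.bdd_deriv
  have := isFiniteMeasure_weightedMeasure ha
  have hKm' : Measurable (fun z => z * K z) := by fun_prop
  have hKi := hK.integrable
  have hKi' := hK.id_mul.integrable
  have hS : SmoothApprox a (fun n => kernelExt K (f n)) (kernelExt K v) (kernelExt K w)
      (fun p => -kernelExt (fun z => z * K z) w p) := by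
    refine ⟨fun n => contDiff_kernelExt hK (hf n), ?_, ?_, ?_⟩
    · have hδ' : Tendsto (fun n => (∫ z, |K z|) * δ n) atTop (𝓝 0) := by
        simpa using hδ.const_mul (∫ z, |K z|)
      refine tendsto_eLpNorm_of_unif hδ' fun n p => ?_
      obtain ⟨B, hB⟩ := (hf n).bound
      rw [kernelExt_sub hKi (hf n).1.continuous.measurable h.measurable_fun hB hC]
      exact abs_kernelExt_le hKi (hfv n) p
    · simp_rw [fun n p => fderiv_kernelExt_fst hK (hf n) p]
      exact tendsto_eLpNorm_kernelExt_sub ha hKm hKi h.measurable_deriv (fun n => (hf n).deriv)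
        hD hfw
    · simp_rw [fun n p => fderiv_kernelExt_snd hK (hf n) p]
      have := tendsto_eLpNorm_kernelExt_sub ha hKm' hKi' h.measurable_deriv
        (fun n => (hf n).deriv) hD hfw
      refine this.congr fun n => ?_
      rw [← eLpNorm_neg]
      congr 1
      ext p
      simp only [Pi.neg_apply]
      ring
  have hmem : ∀ {k : ℝ → ℝ}, Measurable k → Integrable k →
      MemLp (kernelExt k w) 2 (weightedMeasure a) := fun hkm hk =>
    .of_bound (measurable_kernelExt hkm h.measurable_deriv).aestronglyMeasurable _
      (.of_forall (abs_kernelExt_le hk hD))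
  refine ⟨⟨.of_bound (measurable_kernelExt hKm h.measurable_fun).aestronglyMeasurable _
      (.of_forall (abs_kernelExt_le hKi hC)), hmem hKm hKi, (hmem hKm' hKi').neg, _, hS⟩,
    _, hS, ?_⟩
  refine tendsto_eLpNorm_of_unif hδ fun n x => ?_
  have : kernelExt K (f n) (x, 0) = f n x := by
    simp [kernelExt, integral_mul_const, hK1]
  rw [this]
  exact hfv n x

/-- An `L²` function vanishing outside an interval is an `L²` limit of smooth functions vanishing
outside a slightly larger interval. -/
theorem exists_contDiff_eLpNorm_sub_le {f : ℝ → ℝ} (hf : MemLp f 2 volume) {α β δ η : ℝ}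
    (hαβ : α ≤ β) (h0 : ∀ x, x ∉ Icc α β → f x = 0) (hδ : 0 < δ) (hη : 0 < η) :
    ∃ h : ℝ → ℝ, ContDiff ℝ ∞ h ∧ (∀ x, x ∉ Icc (α - δ) (β + δ) → h x = 0) ∧
      eLpNorm (fun x => h x - f x) 2 volume ≤ ENNReal.ofReal η := by
  obtain ⟨g, -, hg, hle⟩ := hf.exist_eLpNorm_sub_le (by simp) (by simp) hη
  -- The bump equals 1 on `[α - δ/2, β + δ/2]`. Since `f = χ f`, cutting off the approximant cannot
  -- increase the error.
  let χ : ContDiffBump ((α + β) / 2) :=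
    ⟨(β - α) / 2 + δ / 2, (β - α) / 2 + δ, by linarith, by linarith⟩
  refine ⟨fun x => χ x * g x, χ.contDiff.mul hg, fun x hx => ?_, ?_⟩
  · have : χ x = 0 := χ.zero_of_le_dist (by
      change (β - α) / 2 + δ ≤ _
      rw [Real.dist_eq]
      by_contra! hlt
      rw [abs_lt] at hlt
      exact hx ⟨by linarith, by linarith⟩)
    simp [this]
  · refine (eLpNorm_mono fun x => ?_).trans hle
    have h1 : f x = χ x * f x := by
      by_cases hx : x ∈ Icc α β
      · have : χ x = 1 := χ.one_of_mem_closedBall (by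
          change dist x _ ≤ (β - α) / 2 + δ / 2
          rw [Real.dist_eq, abs_le]
          exact ⟨by linarith [hx.1], by linarith [hx.2]⟩)
        rw [this, one_mul]
      · simp [h0 x hx]
    have h2 : χ x * g x - f x = χ x * (g x - f x) := by linear_combination -h1
    rw [h2, norm_mul, Pi.sub_apply, norm_sub_rev (f x), Real.norm_of_nonneg χ.nonneg]
    exact mul_le_of_le_one_left (norm_nonneg _) χ.le_one

theorem bddDerivs_of_hasCompactSupport {h : ℝ → ℝ} (hh : ContDiff ℝ ∞ h)
    (hc : HasCompactSupport h) : BddDerivs h := by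
  refine ⟨hh, fun n => ?_⟩
  induction n generalizing h with
  | zero => simpa using hc.exists_bound_of_continuous hh.continuous
  | succ n ih =>
    rw [iteratedDeriv_succ']
    exact ih ((contDiff_infty_iff_deriv (𝕜 := ℝ)).1 hh).2 hc.deriv

theorem hasCompactSupport_of_Icc {h : ℝ → ℝ} {α β : ℝ} (h0 : ∀ x, x ∉ Icc α β → h x = 0) :
    HasCompactSupport h := .intro isCompact_Icc h0

theorem hasDerivAt_primitive {h : ℝ → ℝ} (hh : Continuous h) (L x : ℝ) :
    HasDerivAt (fun x => ∫ t in L..x, h t) (h x) x :=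
  intervalIntegral.integral_hasDerivAt_right (hh.intervalIntegrable _ _)
    hh.aestronglyMeasurable.stronglyMeasurableAtFilter hh.continuousAt

theorem contDiff_primitive {h : ℝ → ℝ} (hh : ContDiff ℝ ∞ h) (L : ℝ) :
    ContDiff ℝ ∞ (fun x => ∫ t in L..x, h t) := by
  refine (contDiff_infty_iff_deriv (𝕜 := ℝ)).2
    ⟨fun x => (hasDerivAt_primitive hh.continuous L x).differentiableAt, ?_⟩
  rwa [funext fun x => (hasDerivAt_primitive hh.continuous L x).deriv]

theorem abs_intervalIntegral_le {g : ℝ → ℝ} (hg : Integrable g) (x y : ℝ) :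
    |∫ t in x..y, g t| ≤ ∫ t, |g t| :=
  (intervalIntegral.norm_integral_le_integral_norm_uIoc).trans
    (setIntegral_le_integral hg.norm (.of_forall fun _ => norm_nonneg _))

theorem bddDerivs_primitive {h : ℝ → ℝ} (hh : ContDiff ℝ ∞ h) (hc : HasCompactSupport h) (L : ℝ) :
    BddDerivs (fun x => ∫ t in L..x, h t) := by
  refine ⟨contDiff_primitive hh L, fun n => ?_⟩
  cases n with
  | zero =>
    exact ⟨_, by simpa using abs_intervalIntegral_le (hh.continuous.integrable_of_hasCompactSupport hc) L⟩
  | succ n =>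
    rw [iteratedDeriv_succ', funext fun x => (hasDerivAt_primitive hh.continuous L x).deriv]
    exact (bddDerivs_of_hasCompactSupport hh hc).2 n

/-- Cauchy-Schwarz on an interval carrying the function. -/
theorem integral_abs_le_of_eLpNorm_le {g : ℝ → ℝ} (hg : MemLp g 2 volume) {L M : ℝ} (hLM : L ≤ M)
    (h0 : ∀ x, x ∉ Icc L M → g x = 0) {η : ℝ} (hη : 0 ≤ η)
    (hle : eLpNorm g 2 volume ≤ ENNReal.ofReal η) :
    Integrable g ∧ ∫ t, |g t| ≤ η * √(M - L) := by
  have hi : IntegrableOn g (Icc L M) :=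
    (hg.restrict (Icc L M)).integrable (by norm_num)
  have hint : Integrable g := (integrableOn_iff_integrable_of_support_subset
    (fun x hx => by by_contra h; exact hx (h0 x h))).1 hi
  refine ⟨hint, ?_⟩
  have h1 : eLpNorm g 1 (volume.restrict (Icc L M)) ≤ ENNReal.ofReal (η * √(M - L)) := by
    refine (eLpNorm_le_eLpNorm_mul_rpow_measure_univ (p := 1) (q := 2) (by norm_num)
      hg.aestronglyMeasurable.restrict).trans ?_
    rw [ENNReal.ofReal_mul hη]
    refine mul_le_mul' ((eLpNorm_mono_measure _ Measure.restrict_le_self).trans hle) ?_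
    rw [Measure.restrict_apply_univ, Real.volume_Icc,
      ENNReal.ofReal_rpow_of_nonneg (by linarith) (by norm_num), Real.sqrt_eq_rpow]
    norm_num
  rw [eLpNorm_one_eq_lintegral_enorm] at h1
  have h2 : ∫⁻ x in Icc L M, ‖g x‖ₑ = ∫⁻ x, ‖g x‖ₑ :=
    setLIntegral_eq_of_support_subset (fun x hx => by
      by_contra h; exact hx (by simp [h0 x h]))
  rw [h2] at h1
  have h3 := integral_norm_eq_lintegral_enorm hint.aestronglyMeasurable
  simp only [Real.norm_eq_abs] at h3
  rw [h3]
  exact ENNReal.toReal_le_of_le_ofReal (by positivity) h1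

/-! ### The affine transition and its smooth approximation -/

/-- The transition from `0` to `1` on a layer of width `l`. -/
noncomputable def ramp (l x : ℝ) : ℝ := max 0 (min 1 (x / l + 1 / 2))

/-- The derivative of `ramp l`. -/
noncomputable def rampDeriv (l : ℝ) : ℝ → ℝ := indicator (Ioo (-l / 2) (l / 2)) fun _ => l⁻¹

theorem continuous_ramp (l : ℝ) : Continuous (ramp l) := by unfold ramp; fun_prop

theorem measurable_rampDeriv (l : ℝ) : Measurable (rampDeriv l) :=
  measurable_const.indicator measurableSet_Ioo

theorem ramp_eq_zero {l x : ℝ} (hl : 0 < l) (hx : x ≤ -l / 2) : ramp l x = 0 := by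
  have : x / l + 1 / 2 ≤ 0 := by
    have : x / l ≤ (-l / 2) / l := by gcongr
    have e : (-l / 2) / l = -1 / 2 := by field_simp
    linarith
  rw [ramp, max_eq_left ((min_le_right _ _).trans this)]

theorem ramp_eq_one {l x : ℝ} (hl : 0 < l) (hx : l / 2 ≤ x) : ramp l x = 1 := by
  have : 1 ≤ x / l + 1 / 2 := by
    have : (l / 2) / l ≤ x / l := by gcongr
    have e : (l / 2) / l = 1 / 2 := by field_simp
    linarith
  rw [ramp, min_eq_left this, max_eq_right zero_le_one]

theorem ramp_eq_affine {l x : ℝ} (hl : 0 < l) (hx : x ∈ Icc (-l / 2) (l / 2)) :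
    ramp l x = x / l + 1 / 2 := by
  have h1 : x / l + 1 / 2 ≤ 1 := by
    have : x / l ≤ (l / 2) / l := by gcongr; exact hx.2
    have e : (l / 2) / l = 1 / 2 := by field_simp
    linarith
  have h2 : 0 ≤ x / l + 1 / 2 := by
    have : (-l / 2) / l ≤ x / l := by gcongr; exact hx.1
    have e : (-l / 2) / l = -1 / 2 := by field_simp
    linarith
  rw [ramp, min_eq_right h1, max_eq_right h2]

theorem abs_ramp_le (l x : ℝ) : |ramp l x| ≤ 1 := by
  rw [ramp, abs_of_nonneg (le_max_left _ _)]
  exact max_le zero_le_one (min_le_left _ _)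

theorem abs_rampDeriv_le {l : ℝ} (hl : 0 < l) (x : ℝ) : |rampDeriv l x| ≤ l⁻¹ := by
  unfold rampDeriv
  by_cases hx : x ∈ Ioo (-l / 2) (l / 2)
  · simp [hx, abs_of_pos hl]
  · simp [hx, hl.le]

theorem hasDerivAt_ramp {l x : ℝ} (hl : 0 < l) (hx : x ∉ ({-l / 2, l / 2} : Set ℝ)) :
    HasDerivAt (ramp l) (rampDeriv l x) x := by
  simp only [mem_insert_iff, mem_singleton_iff, not_or] at hx
  rcases lt_or_gt_of_ne hx.1 with h | h
  · have : rampDeriv l x = 0 := indicator_of_notMem (fun hm => hm.1.not_gt h) _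
    rw [this]
    refine (hasDerivAt_const x (0 : ℝ)).congr_of_eventuallyEq ?_
    filter_upwards [Iio_mem_nhds h] with y hy using ramp_eq_zero hl (le_of_lt hy)
  rcases lt_or_gt_of_ne hx.2 with h' | h'
  · have : rampDeriv l x = 1 / l := by
      rw [one_div]; exact indicator_of_mem (show x ∈ Ioo (-l / 2) (l / 2) from ⟨h, h'⟩) _
    rw [this]
    refine (((hasDerivAt_id x).div_const l).add_const (1 / 2)).congr_of_eventuallyEq ?_
    filter_upwards [Ioo_mem_nhds h h'] with y hy using ramp_eq_affine hl (Ioo_subset_Icc_self hy)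
  · have : rampDeriv l x = 0 := indicator_of_notMem (fun hm => hm.2.not_gt h') _
    rw [this]
    refine (hasDerivAt_const x (1 : ℝ)).congr_of_eventuallyEq ?_
    filter_upwards [Ioi_mem_nhds h'] with y hy using ramp_eq_one hl (le_of_lt hy)

theorem memLp_rampDeriv (l : ℝ) (p : ℝ≥0∞) : MemLp (rampDeriv l) p volume :=
  memLp_indicator_const p measurableSet_Ioo _ (Or.inr (by simp))

theorem integrable_rampDeriv (l : ℝ) : Integrable (rampDeriv l) :=
  memLp_one_iff_integrable.1 (memLp_rampDeriv l 1)

theorem integral_rampDeriv {l : ℝ} (hl : 0 < l) (x y : ℝ) :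
    ∫ t in x..y, rampDeriv l t = ramp l y - ramp l x :=
  integral_eq_of_hasDerivAt_off_countable (ramp l) (rampDeriv l)
    (s := {-l / 2, l / 2}) (by simp) (continuous_ramp l).continuousOn
    (fun _ ht => hasDerivAt_ramp hl ht.2) (integrable_rampDeriv l).intervalIntegrable

/-- The approximants are primitives of smooth functions that vanish off `[-l, l]` and tend to
`rampDeriv l` in `L²`. On this bounded interval Cauchy–Schwarz bounds the `L¹` error, hence the
uniform error of the primitives. -/
theorem smoothLimit_ramp {l : ℝ} (hl : 0 < l) : SmoothLimit (ramp l) (rampDeriv l) := by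
  refine ⟨(continuous_ramp l).measurable, measurable_rampDeriv l, ⟨1, abs_ramp_le l⟩,
    ⟨_, abs_rampDeriv_le hl⟩, memLp_rampDeriv l 2, ?_⟩
  have hw0 : ∀ x, x ∉ Icc (-l / 2) (l / 2) → rampDeriv l x = 0 := fun x hx =>
    indicator_of_notMem (fun h => hx (Ioo_subset_Icc_self h)) _
  have hη : ∀ n : ℕ, (0 : ℝ) < 1 / (n + 1) := fun n => by positivity
  choose h hh hs hle using fun n : ℕ => exists_contDiff_eLpNorm_sub_le (memLp_rampDeriv l 2)
    (by linarith : -l / 2 ≤ l / 2) hw0 (half_pos hl) (hη n)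
  have e1 : -l / 2 - l / 2 = -l := by ring
  have e2 : l / 2 + l / 2 = l := by ring
  simp only [e1, e2] at hs
  refine ⟨fun n x => ∫ t in (-l)..x, h n t, fun n => 1 / (n + 1) * √(l - -l), fun n =>
    bddDerivs_primitive (hh n) (hasCompactSupport_of_Icc (hs n)) _, ?_, fun n x => ?_, ?_⟩
  · simpa using tendsto_one_div_add_atTop_nhds_zero_nat.mul_const (√(l - -l))
  · have hhL : MemLp (h n) 2 volume :=
      (hh n).continuous.memLp_of_hasCompactSupport (hasCompactSupport_of_Icc (hs n))
    obtain ⟨hi, hle'⟩ := integral_abs_le_of_eLpNorm_le (g := fun t => h n t - rampDeriv l t)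
      (hhL.sub (memLp_rampDeriv l 2)) (by linarith : -l ≤ l)
      (fun x hx => by
        rw [hs n x hx, hw0 x fun hm => hx ⟨by linarith [hm.1], by linarith [hm.2]⟩, sub_zero])
      (hη n).le (hle n)
    have h1 : ramp l x = ∫ t in (-l)..x, rampDeriv l t := by
      rw [integral_rampDeriv hl, ramp_eq_zero hl (by linarith : -l ≤ -l / 2), sub_zero]
    rw [h1, ← intervalIntegral.integral_sub ((hh n).continuous.intervalIntegrable _ _)
      (integrable_rampDeriv l).intervalIntegrable]
    exact (abs_intervalIntegral_le hi _ _).trans hle'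
  · simp_rw [fun n x => (hasDerivAt_primitive (hh n).continuous (-l) x).deriv]
    refine tendsto_of_tendsto_of_tendsto_of_le_of_le tendsto_const_nhds ?_ (fun _ => zero_le) hle
    simpa using ENNReal.tendsto_ofReal tendsto_one_div_add_atTop_nhds_zero_nat

/-! ### The constant `d_s` and the Gagliardo seminorm on the Fourier side -/

theorem lintegral_comp_mul_left {f : ℝ → ℝ≥0∞} (hf : Measurable f) {c : ℝ} (hc : c ≠ 0) :
    ∫⁻ x, f (c * x) = ENNReal.ofReal |c⁻¹| * ∫⁻ x, f x := by
  rw [← lintegral_map hf (measurable_const_mul c), Real.map_volume_mul_left hc,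
    lintegral_smul_measure, smul_eq_mul]

theorem setLIntegral_Ioi_comp_mul_left {f : ℝ → ℝ≥0∞} (hf : Measurable f) {c : ℝ} (hc : 0 < c) :
    ∫⁻ x in Ioi 0, f (c * x) = ENNReal.ofReal c⁻¹ * ∫⁻ x in Ioi 0, f x := by
  rw [← lintegral_indicator measurableSet_Ioi, ← lintegral_indicator measurableSet_Ioi]
  have h := lintegral_comp_mul_left (hf.indicator (measurableSet_Ioi (a := (0 : ℝ)))) hc.ne'
  rw [abs_of_pos (inv_pos.2 hc)] at h
  rw [← h]
  refine lintegral_congr fun x => ?_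
  simp [indicator, hc]

/-- The integrand of `dConst`. -/
noncomputable def dIntegrand (s z : ℝ) : ℝ := (2 - 2 * Real.cos z) / |z| ^ (1 + 2 * s)

theorem dIntegrand_nonneg (s z : ℝ) : 0 ≤ dIntegrand s z :=
  div_nonneg (by linarith [Real.cos_le_one z]) (by positivity)

theorem measurable_dIntegrand (s : ℝ) : Measurable (dIntegrand s) := by
  unfold dIntegrand; fun_prop

/-- Near the origin `2 - 2 cos z ≤ z²` leaves the exponent `1 - 2s > -1`. At infinity the numerator
is at most 4 and the exponent is `-(1 + 2s) < -1`. -/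
theorem integrable_dIntegrand {s : ℝ} (hs : 0 < s) (hs1 : s < 1) : Integrable (dIntegrand s) := by
  have hpos : IntegrableOn (dIntegrand s) (Ioi 0) := by
    rw [← Ioc_union_Ioi_eq_Ioi zero_le_one]
    refine IntegrableOn.union ?_ ?_
    · have h1 : IntegrableOn (fun z : ℝ => z ^ (1 - 2 * s)) (Ioc 0 1) := by
        rw [integrableOn_Ioc_iff_integrableOn_Ioo]
        exact (intervalIntegral.integrableOn_Ioo_rpow_iff zero_lt_one).2 (by linarith)
      refine h1.mono' (measurable_dIntegrand s).aestronglyMeasurable ?_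
      refine (ae_restrict_iff' measurableSet_Ioc).2 (.of_forall fun z hz => ?_)
      rw [Real.norm_of_nonneg (dIntegrand_nonneg s z), dIntegrand, abs_of_pos hz.1,
        div_le_iff₀ (Real.rpow_pos_of_pos hz.1 _), ← Real.rpow_add hz.1]
      have : 1 - 2 * s + (1 + 2 * s) = (2 : ℕ) := by norm_num
      rw [this, Real.rpow_natCast]
      linarith [Real.one_sub_sq_div_two_le_cos (x := z)]
    · have h1 : IntegrableOn (fun z : ℝ => 4 * z ^ (-(1 + 2 * s))) (Ioi 1) :=
        (integrableOn_Ioi_rpow_of_lt (by linarith) zero_lt_one).const_mul 4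
      refine h1.mono' (measurable_dIntegrand s).aestronglyMeasurable ?_
      refine (ae_restrict_iff' measurableSet_Ioi).2 (.of_forall fun z hz => ?_)
      have hz0 : 0 < z := zero_lt_one.trans hz
      rw [Real.norm_of_nonneg (dIntegrand_nonneg s z), dIntegrand, abs_of_pos hz0,
        Real.rpow_neg hz0.le, ← div_eq_mul_inv]
      gcongr
      linarith [Real.neg_one_le_cos z]
  have hneg : IntegrableOn (dIntegrand s) (Iio 0) := by
    have := hpos.comp_neg
    have e : (fun x => dIntegrand s (-x)) = dIntegrand s := by ext x; simp [dIntegrand]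
    simpa [e] using this
  rw [← integrableOn_univ, ← Iic_union_Ioi (a := (0 : ℝ))]
  exact ((integrableOn_Iic_iff_integrableOn_Iio).2 hneg).union hpos

theorem lintegral_dIntegrand {s : ℝ} (hs : 0 < s) (hs1 : s < 1) :
    ∫⁻ z, ENNReal.ofReal (dIntegrand s z) = ENNReal.ofReal (dConst s) :=
  (ofReal_integral_eq_lintegral_ofReal (integrable_dIntegrand hs hs1)
    (.of_forall (dIntegrand_nonneg s))).symm

theorem dConst_pos {s : ℝ} (hs : 0 < s) (hs1 : s < 1) : 0 < dConst s := by
  refine (integral_pos_iff_support_of_nonneg (dIntegrand_nonneg s)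
    (integrable_dIntegrand hs hs1)).2 ?_
  refine lt_of_lt_of_le ?_ (measure_mono (s := Ioo 0 1) fun z hz => ?_)
  · simp
  · have : Real.cos z < 1 := by
      have := Real.cos_lt_cos_of_nonneg_of_le_pi le_rfl (by linarith [Real.pi_gt_three, hz.2]) hz.1
      simpa using this
    exact (div_pos (by linarith) (Real.rpow_pos_of_pos (abs_pos.2 hz.1.ne') _)).ne'

theorem norm_exp_sub_exp_sq (A B : ℝ) :
    ‖Complex.exp (A * Complex.I) - Complex.exp (B * Complex.I)‖ ^ 2 = 2 - 2 * Real.cos (A - B) := by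
  rw [Complex.sq_norm, Complex.normSq_apply, Complex.sub_re, Complex.sub_im,
    Complex.exp_ofReal_mul_I_re, Complex.exp_ofReal_mul_I_re, Complex.exp_ofReal_mul_I_im,
    Complex.exp_ofReal_mul_I_im, Real.cos_sub]
  linear_combination Real.sin_sq_add_cos_sq A + Real.sin_sq_add_cos_sq B

theorem norm_realFourier_indicator_sq {α β ξ : ℝ} (hαβ : α ≤ β) (hξ : ξ ≠ 0) :
    ‖realFourier (indicator (Ioo α β) fun _ => 1) ξ‖ ^ 2 =
      (2 - 2 * Real.cos (2 * Real.pi * ξ * (β - α))) / (2 * Real.pi * ξ) ^ 2 := by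
  have hc : (-(2 * Real.pi * ξ : ℝ) * Complex.I : ℂ) ≠ 0 := by
    simp [hξ, Real.pi_ne_zero]
  have h1 : realFourier (indicator (Ioo α β) fun _ => 1) ξ =
      ∫ x in α..β, Complex.exp ((-(2 * Real.pi * ξ : ℝ) * Complex.I) * x) := by
    unfold realFourier
    rw [Real.fourier_real_eq_integral_exp_smul, intervalIntegral.integral_of_le hαβ,
      integral_Ioc_eq_integral_Ioo, ← integral_indicator measurableSet_Ioo]
    refine integral_congr_ae (.of_forall fun x => ?_)
    by_cases hx : x ∈ Ioo α β
    · simp only [indicator_of_mem hx, Complex.ofReal_one, smul_eq_mul, mul_one]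
      congr 1
      push_cast
      ring
    · simp [indicator_of_notMem hx]
  rw [h1, integral_exp_mul_complex hc, norm_div, div_pow]
  have h2 : ∀ t : ℝ, (-(2 * Real.pi * ξ : ℝ) * Complex.I) * (t : ℂ) =
      ((-(2 * Real.pi * ξ) * t : ℝ) : ℂ) * Complex.I := fun t => by push_cast; ring
  rw [h2, h2, norm_exp_sub_exp_sq]
  congr 1
  · rw [← Real.cos_neg]
    congr 3
    ring
  · rw [norm_mul, Complex.norm_I, mul_one, norm_neg, Complex.norm_real, Real.norm_eq_abs, sq_abs]

theorem enorm_realFourier_indicator_sq {α β ξ : ℝ} (hαβ : α ≤ β) (hξ : ξ ≠ 0) :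
    ‖realFourier (indicator (Ioo α β) fun _ => 1) ξ‖ₑ ^ 2 = ENNReal.ofReal
      ((2 - 2 * Real.cos (2 * Real.pi * ξ * (β - α))) / (2 * Real.pi * ξ) ^ 2) := by
  rw [← norm_realFourier_indicator_sq hαβ hξ, ENNReal.ofReal_pow (norm_nonneg _), ofReal_norm]

/-- The squared modulus of the Fourier transform of `rampDeriv 1`. -/
noncomputable def rampSpectrum (ξ : ℝ) : ℝ :=
  (2 - 2 * Real.cos (2 * Real.pi * ξ)) / (2 * Real.pi * ξ) ^ 2

theorem rampSpectrum_nonneg (ξ : ℝ) : 0 ≤ rampSpectrum ξ :=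
  div_nonneg (by linarith [Real.cos_le_one (2 * Real.pi * ξ)]) (by positivity)

theorem measurable_rampSpectrum : Measurable rampSpectrum := by
  unfold rampSpectrum; fun_prop

theorem enorm_realFourier_rampDeriv_sq :
    (fun ξ => ‖realFourier (rampDeriv 1) ξ‖ₑ ^ 2) =ᵐ[volume]
      fun ξ => ENNReal.ofReal (rampSpectrum ξ) := by
  filter_upwards [Measure.ae_ne volume 0] with ξ hξ
  have := enorm_realFourier_indicator_sq (α := -1 / 2) (β := 1 / 2) (by norm_num) hξ
  have e : (1 / 2 - -1 / 2 : ℝ) = 1 := by norm_num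
  rw [e, mul_one] at this
  -- The layer of width 1 has slope 1, so no further factor appears.
  simpa [rampDeriv, rampSpectrum] using this

/-- The weighted energy `∫ |ŵ(ξ)|² |2πξ|^{2s-2} dξ` of `w = rampDeriv 1`. -/
noncomputable def spectralEnergy (s : ℝ) : ℝ := dConst (3 / 2 - s) / (2 * Real.pi)

theorem spectralEnergy_pos {s : ℝ} (hs : 1 / 2 < s) (hs1 : s < 1) : 0 < spectralEnergy s :=
  div_pos (dConst_pos (by linarith) (by linarith)) (by positivity)

/-- With `z = 2πξ` the integrand is `(2 - 2 cos z) / |z|^{4-2s}`, and `4 - 2s = 1 + 2(3/2 - s)`.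
Convergence at the origin requires `3/2 - s < 1`, that is `s > 1/2`. -/
theorem lintegral_rampSpectrum {s : ℝ} (hs : 1 / 2 < s) (hs1 : s < 1) :
    ∫⁻ ξ, ENNReal.ofReal (rampSpectrum ξ) * ENNReal.ofReal (|2 * Real.pi * ξ| ^ (2 * s - 2)) =
      ENNReal.ofReal (spectralEnergy s) := by
  have h := lintegral_comp_mul_left (measurable_dIntegrand (3 / 2 - s)).ennreal_ofReal
    (c := 2 * Real.pi) (by positivity)
  rw [lintegral_dIntegrand (by linarith) (by linarith), ← ENNReal.ofReal_mul (by positivity),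
    abs_of_pos (by positivity), inv_mul_eq_div] at h
  rw [spectralEnergy, ← h]
  refine lintegral_congr_ae ?_
  filter_upwards [Measure.ae_ne volume 0] with ξ hξ
  rw [← ENNReal.ofReal_mul (rampSpectrum_nonneg ξ), rampSpectrum, dIntegrand]
  congr 1
  have h0 : 0 < |2 * Real.pi * ξ| := by positivity
  rw [← sq_abs (2 * Real.pi * ξ), ← Real.rpow_natCast, div_mul_eq_mul_div, mul_div_assoc,
    ← Real.rpow_sub h0, div_eq_mul_inv, ← Real.rpow_neg h0.le]
  congr 2
  push_cast
  ring

/-- The integrand of the Gagliardo seminorm. -/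
noncomputable def gagliardoIntegrand (s : ℝ) (v : ℝ → ℝ) (q : ℝ × ℝ) : ℝ :=
  |v q.1 - v q.2| ^ 2 / |q.1 - q.2| ^ (1 + 2 * s)

theorem gagliardoIntegrand_nonneg (s : ℝ) (v : ℝ → ℝ) (q : ℝ × ℝ) :
    0 ≤ gagliardoIntegrand s v q := by unfold gagliardoIntegrand; positivity

theorem measurable_gagliardoIntegrand (s : ℝ) {v : ℝ → ℝ} (hv : Measurable v) :
    Measurable (gagliardoIntegrand s v) := by
  unfold gagliardoIntegrand
  have : Measurable fun x : ℝ => |x| := continuous_abs.measurable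
  fun_prop

/-- The ramp is not square integrable, but its increment over a step `h` is, up to sign, the
convolution of its derivative with the indicator of an interval of length `|h|`, to which Plancherel
applies. -/
theorem lintegral_ramp_translate_sq (h : ℝ) :
    ∫⁻ x, ENNReal.ofReal (|ramp 1 x - ramp 1 (x + h)| ^ 2) =
      ∫⁻ ξ, ENNReal.ofReal ((2 - 2 * Real.cos (2 * Real.pi * ξ * h)) / (2 * Real.pi * ξ) ^ 2) *
        ENNReal.ofReal (rampSpectrum ξ) := by
  -- `(A, B)` is the interval between `-h` and `0`, oriented so that both signs of `h` are covered.
  set A := -max 0 h with hA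
  set B := -min 0 h with hB
  have hAB : A ≤ B := neg_le_neg (min_le_max)
  have hd : B - A = |h| := by
    rw [hA, hB, neg_sub_neg, max_sub_min_eq_abs]; simp
  set k : ℝ → ℝ := indicator (Ioo A B) fun _ => 1 with hk
  have hki : Integrable k :=
    memLp_one_iff_integrable.1 (memLp_indicator_const 1 measurableSet_Ioo _ (Or.inr (by simp)))
  have h1 := lintegral_enorm_convolution_sq hki (integrable_rampDeriv 1)
    (abs_rampDeriv_le zero_lt_one)
  have h2 : ∀ x, ∫ z, k z * rampDeriv 1 (x - z) = ramp 1 (x - A) - ramp 1 (x - B) := fun x => by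
    rw [← integral_rampDeriv zero_lt_one, ← intervalIntegral.integral_comp_sub_left,
      intervalIntegral.integral_of_le hAB, integral_Ioc_eq_integral_Ioo,
      ← integral_indicator measurableSet_Ioo]
    congr 1
    ext z
    by_cases hz : z ∈ Ioo A B <;> simp [hk, hz]
  have h3 : ∀ x, ENNReal.ofReal (|ramp 1 x - ramp 1 (x + h)| ^ 2) =
      ‖∫ z, k z * rampDeriv 1 (x - z)‖ₑ ^ 2 := fun x => by
    rw [h2, ENNReal.ofReal_pow (abs_nonneg _), ← Real.norm_eq_abs, ofReal_norm, hA, hB]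
    rcases le_total 0 h with h0 | h0
    · rw [max_eq_right h0, min_eq_left h0, ← ofReal_norm, ← ofReal_norm, norm_sub_rev]
      simp
    · rw [max_eq_left h0, min_eq_right h0]
      simp
  simp_rw [h3]
  rw [h1]
  refine lintegral_congr_ae ?_
  filter_upwards [Measure.ae_ne volume 0, enorm_realFourier_rampDeriv_sq] with ξ hξ hw
  rw [hw, enorm_realFourier_indicator_sq hAB hξ, hd]
  congr 4
  rcases abs_choice h with e | e <;> rw [e]
  rw [mul_neg, Real.cos_neg]

/-- In the variables `x` and `h = x' - x` the inner integral is a translation increment. After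
Plancherel and Tonelli, the substitution `z = 2πξh` in the `h`-integral splits off `d_s` at every
frequency and leaves the weight `|2πξ|^{2s-2}`. -/
theorem lintegral_gagliardoIntegrand_ramp {s : ℝ} (hs : 1 / 2 < s) (hs1 : s < 1) :
    ∫⁻ q, ENNReal.ofReal (gagliardoIntegrand s (ramp 1) q) =
      ENNReal.ofReal (dConst s * spectralEnergy s) := by
  have hm := measurable_gagliardoIntegrand s (continuous_ramp 1).measurable
  have hr := (continuous_ramp 1).measurable
  have ha : Measurable fun x : ℝ => |x| := continuous_abs.measurable
  have hsp := measurable_rampSpectrum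
  calc ∫⁻ q, ENNReal.ofReal (gagliardoIntegrand s (ramp 1) q)
      = ∫⁻ x, ∫⁻ h, ENNReal.ofReal (|h| ^ (-(1 + 2 * s))) *
          ENNReal.ofReal (|ramp 1 x - ramp 1 (x + h)| ^ 2) := by
        rw [Measure.volume_eq_prod, lintegral_prod _ hm.ennreal_ofReal.aemeasurable]
        refine lintegral_congr fun x => ?_
        rw [← lintegral_add_left_eq_self _ x]
        refine lintegral_congr fun h => ?_
        rw [← ENNReal.ofReal_mul (by positivity), gagliardoIntegrand, sub_add_cancel_left, abs_neg,
          Real.rpow_neg (abs_nonneg h), div_eq_inv_mul]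
    _ = ∫⁻ h, ENNReal.ofReal (|h| ^ (-(1 + 2 * s))) *
          ∫⁻ x, ENNReal.ofReal (|ramp 1 x - ramp 1 (x + h)| ^ 2) := by
        rw [lintegral_lintegral_swap (by fun_prop)]
        refine lintegral_congr fun h => ?_
        rw [lintegral_const_mul _ (by fun_prop)]
    _ = ∫⁻ h, ∫⁻ ξ, ENNReal.ofReal (|h| ^ (-(1 + 2 * s))) *
          (ENNReal.ofReal ((2 - 2 * Real.cos (2 * Real.pi * ξ * h)) / (2 * Real.pi * ξ) ^ 2) *
          ENNReal.ofReal (rampSpectrum ξ)) := by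
        refine lintegral_congr fun h => ?_
        rw [lintegral_ramp_translate_sq, lintegral_const_mul _ (by fun_prop)]
    _ = ∫⁻ ξ, ∫⁻ h, ENNReal.ofReal (|h| ^ (-(1 + 2 * s))) *
          (ENNReal.ofReal ((2 - 2 * Real.cos (2 * Real.pi * ξ * h)) / (2 * Real.pi * ξ) ^ 2) *
          ENNReal.ofReal (rampSpectrum ξ)) := lintegral_lintegral_swap (by fun_prop)
    _ = ∫⁻ ξ, ENNReal.ofReal (dConst s) * (ENNReal.ofReal (rampSpectrum ξ) *
          ENNReal.ofReal (|2 * Real.pi * ξ| ^ (2 * s - 2))) := by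
        refine lintegral_congr_ae ?_
        filter_upwards [Measure.ae_ne volume 0] with ξ hξ
        have hc : 2 * Real.pi * ξ ≠ 0 := by positivity
        have hc' : 0 < |2 * Real.pi * ξ| := abs_pos.2 hc
        have hi := lintegral_comp_mul_left (measurable_dIntegrand s).ennreal_ofReal hc
        rw [lintegral_dIntegrand (by linarith) hs1] at hi
        have e : ∀ h, ENNReal.ofReal (|h| ^ (-(1 + 2 * s))) *
          (ENNReal.ofReal ((2 - 2 * Real.cos (2 * Real.pi * ξ * h)) / (2 * Real.pi * ξ) ^ 2) *
          ENNReal.ofReal (rampSpectrum ξ)) = ENNReal.ofReal (|2 * Real.pi * ξ| ^ (2 * s - 1)) *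
          ENNReal.ofReal (rampSpectrum ξ) *
            ENNReal.ofReal (dIntegrand s (2 * Real.pi * ξ * h)) := fun h => by
          have e1 : |h| ^ (-(1 + 2 * s)) *
              ((2 - 2 * Real.cos (2 * Real.pi * ξ * h)) / (2 * Real.pi * ξ) ^ 2) =
              |2 * Real.pi * ξ| ^ (2 * s - 1) * dIntegrand s (2 * Real.pi * ξ * h) := by
            have e2 : |2 * Real.pi * ξ| ^ (1 + 2 * s) =
                |2 * Real.pi * ξ| ^ (2 * s - 1) * (2 * Real.pi * ξ) ^ 2 := by
              rw [← sq_abs (2 * Real.pi * ξ), ← Real.rpow_natCast, ← Real.rpow_add hc']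
              congr 1
              push_cast
              ring
            rw [dIntegrand, abs_mul (2 * Real.pi * ξ) h, Real.mul_rpow hc'.le (abs_nonneg h), e2,
              Real.rpow_neg (abs_nonneg h)]
            have : |2 * Real.pi * ξ| ^ (2 * s - 1) ≠ 0 := (Real.rpow_pos_of_pos hc' _).ne'
            generalize |2 * Real.pi * ξ| ^ (2 * s - 1) = r at this ⊢
            generalize |h| ^ (1 + 2 * s) = t
            generalize (2 * Real.pi * ξ) ^ 2 = u
            rw [mul_assoc r, ← mul_div_assoc r, mul_div_mul_left _ _ this, mul_comm u t,
              ← div_div, ← mul_div_assoc, ← div_eq_inv_mul]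
          rw [← mul_assoc, ← ENNReal.ofReal_mul (by positivity), e1,
            ENNReal.ofReal_mul (by positivity)]
          ring
        simp_rw [e]
        have hmd := measurable_dIntegrand s
        rw [lintegral_const_mul _ (by fun_prop), hi]
        have e3 : |2 * Real.pi * ξ| ^ (2 * s - 2) =
            |2 * Real.pi * ξ| ^ (2 * s - 1) * |(2 * Real.pi * ξ)⁻¹| := by
          rw [abs_inv, ← Real.rpow_neg_one, ← Real.rpow_add hc']
          congr 1
          ring
        rw [e3, ENNReal.ofReal_mul (by positivity)]
        ring
    _ = _ := by
        rw [lintegral_const_mul _ (by fun_prop), lintegral_rampSpectrum hs hs1,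
          ENNReal.ofReal_mul (dConst_pos (by linarith) hs1).le]

/-! ### Energy of the extension in the half-plane -/

/-- The energy of the kernel extension of `ramp 1` to the half-plane. -/
theorem lintegral_energy_kernelExt {a s : ℝ} (hs : s = (1 - a) / 2) (hs2 : 1 / 2 < s) (hs1 : s < 1)
    {K : ℝ → ℝ} (hKm : Measurable K) (hK : HasMoments K) {P : ℝ → ℝ≥0∞} (hP : Measurable P)
    (hKP : ∀ ξ, ‖realFourier K ξ‖ₑ ^ 2 + ‖realFourier (fun z => z * K z) ξ‖ₑ ^ 2 =
      P |2 * Real.pi * ξ|) :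
    ∫⁻ p in univ ×ˢ Ioi 0, ENNReal.ofReal ((kernelExt K (rampDeriv 1) p ^ 2 +
      (-kernelExt (fun z => z * K z) (rampDeriv 1) p) ^ 2) * p.2 ^ a) =
      (∫⁻ t in Ioi 0, P t * ENNReal.ofReal (t ^ a)) * ENNReal.ofReal (spectralEnergy s) := by
  have hw := measurable_rampDeriv 1
  have hwb := abs_rampDeriv_le zero_lt_one
  have hwi := integrable_rampDeriv 1
  have hKm' : Measurable fun z => z * K z := by fun_prop
  have hE := measurable_kernelExt hKm hw
  have hE' := measurable_kernelExt hKm' hw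
  have hsp := measurable_rampSpectrum
  have ha : Measurable fun x : ℝ => |x| := continuous_abs.measurable
  have hsq : ∀ r : ℝ, ENNReal.ofReal (r ^ 2) = ‖r‖ₑ ^ 2 := fun r => by
    rw [← sq_abs, ENNReal.ofReal_pow (abs_nonneg r), ← Real.norm_eq_abs, ofReal_norm]
  rw [lintegral_prod_set (by fun_prop)]
  calc _ = ∫⁻ y in Ioi (0 : ℝ), ∫⁻ ξ, ENNReal.ofReal (rampSpectrum ξ) *
        (P (|2 * Real.pi * ξ| * y) * ENNReal.ofReal (y ^ a)) := by
        refine setLIntegral_congr_fun measurableSet_Ioi fun y hy => ?_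
        have hy0 : (0 : ℝ) < y := hy
        have e : ∀ x, ENNReal.ofReal ((kernelExt K (rampDeriv 1) (x, y) ^ 2 +
            (-kernelExt (fun z => z * K z) (rampDeriv 1) (x, y)) ^ 2) * (x, y).2 ^ a) =
            ENNReal.ofReal (y ^ a) * (‖kernelExt K (rampDeriv 1) (x, y)‖ₑ ^ 2 +
              ‖kernelExt (fun z => z * K z) (rampDeriv 1) (x, y)‖ₑ ^ 2) := fun x => by
          rw [ENNReal.ofReal_mul (by positivity), ENNReal.ofReal_add (by positivity)
            (by positivity), neg_sq, hsq, hsq, mul_comm]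
        simp_rw [e]
        rw [Measure.restrict_univ, lintegral_const_mul _ (by fun_prop),
          lintegral_add_left (by fun_prop)]
        have h1 := lintegral_enorm_dilated_convolution_sq hK.integrable hwi hwb hy0
        have h2 := lintegral_enorm_dilated_convolution_sq hK.id_mul.integrable hwi hwb hy0
        simp only [kernelExt]
        have hc := realFourier_continuous hK.integrable
        have hcw := realFourier_continuous hwi
        rw [h1, h2, ← lintegral_add_left (by fun_prop), ← lintegral_const_mul' _ _ (by simp)]
        refine lintegral_congr_ae ?_
        filter_upwards [enorm_realFourier_rampDeriv_sq] with ξ hξ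
        rw [← add_mul, hKP, hξ, ← abs_of_pos hy0, ← abs_mul, abs_of_pos hy0]
        rw [show 2 * Real.pi * (y * ξ) = 2 * Real.pi * ξ * y by ring]
        ring
    _ = ∫⁻ ξ, ∫⁻ y in Ioi (0 : ℝ), ENNReal.ofReal (rampSpectrum ξ) *
        (P (|2 * Real.pi * ξ| * y) * ENNReal.ofReal (y ^ a)) :=
        lintegral_lintegral_swap (by fun_prop)
    _ = ∫⁻ ξ, (∫⁻ t in Ioi 0, P t * ENNReal.ofReal (t ^ a)) * (ENNReal.ofReal (rampSpectrum ξ) *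
          ENNReal.ofReal (|2 * Real.pi * ξ| ^ (2 * s - 2))) := by
        refine lintegral_congr_ae ?_
        filter_upwards [Measure.ae_ne volume 0] with ξ hξ
        have hc' : 0 < |2 * Real.pi * ξ| := by positivity
        set c := |2 * Real.pi * ξ| with hc
        rw [lintegral_const_mul _ (by fun_prop)]
        have h1 := setLIntegral_Ioi_comp_mul_left
          (f := fun t => P t * ENNReal.ofReal (t ^ a)) (by fun_prop) hc'
        -- The substitution `t = c y` contributes `c^{-a}` from the weight and `c⁻¹` from the
        -- measure, together `c^{2s-2}` since `a = 1 - 2s`.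
        have h2 : ∫⁻ y in Ioi (0 : ℝ), P (c * y) * ENNReal.ofReal (y ^ a) =
            ∫⁻ y in Ioi (0 : ℝ), ENNReal.ofReal (c ^ (-a)) *
              (P (c * y) * ENNReal.ofReal ((c * y) ^ a)) := by
          refine setLIntegral_congr_fun measurableSet_Ioi fun y hy => ?_
          have hy0 : (0 : ℝ) < y := hy
          have : y ^ a = c ^ (-a) * (c * y) ^ a := by
            rw [Real.mul_rpow hc'.le hy0.le, ← mul_assoc, ← Real.rpow_add hc']
            simp
          rw [this, ENNReal.ofReal_mul (by positivity)]
          ring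
        rw [h2, lintegral_const_mul _ (by fun_prop), h1]
        have e3 : c ^ (2 * s - 2) = c ^ (-a) * c⁻¹ := by
          rw [← Real.rpow_neg_one, ← Real.rpow_add hc']
          congr 1
          rw [hs]
          ring
        rw [e3, ENNReal.ofReal_mul (by positivity)]
        ring
    _ = _ := by
        rw [lintegral_const_mul _ (by fun_prop), lintegral_rampSpectrum hs2 hs1]

/-! ### Kernels with a prescribed profile as symbol -/

/-- Even test functions equal to `1` at the origin. -/
structure SmoothProfile (ψ : ℝ → ℝ) : Prop where
  contDiff : ContDiff ℝ ∞ ψ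
  even : ∀ t, ψ (-t) = ψ t
  hasCompactSupport : HasCompactSupport ψ
  zero : ψ 0 = 1

theorem SmoothProfile.deriv_neg {ψ : ℝ → ℝ} (h : SmoothProfile ψ) (t : ℝ) :
    deriv ψ (-t) = -deriv ψ t := by
  have h1 := deriv_comp_neg ψ t
  rw [show (fun x => ψ (-x)) = ψ from funext h.even] at h1
  rw [h1, neg_neg]

theorem fourier_fourier_schwartz (f : SchwartzMap ℝ ℂ) (ξ : ℝ) : 𝓕 (𝓕 (f : ℝ → ℂ)) ξ = f (-ξ) := by
  have h : 𝓕⁻ (𝓕 f) = f := FourierTransform.fourierInv_fourier_eq f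
  have h2 := congrArg (fun g : SchwartzMap ℝ ℂ => g (-ξ)) h
  simp only [SchwartzMap.fourierInv_coe, SchwartzMap.fourier_coe] at h2
  rw [← h2, Real.fourierInv_eq_fourier_neg, neg_neg]

/-- A test profile is the symbol of a real kernel with moments of all orders. -/
theorem SmoothProfile.exists_kernel {ψ : ℝ → ℝ} (h : SmoothProfile ψ) :
    ∃ K : ℝ → ℝ, Measurable K ∧ HasMoments K ∧ ∫ z, K z = 1 ∧
      ∀ ξ, ‖realFourier K ξ‖ₑ ^ 2 + ‖realFourier (fun z => z * K z) ξ‖ₑ ^ 2 =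
        ENNReal.ofReal (deriv ψ |2 * Real.pi * ξ| ^ 2 + ψ |2 * Real.pi * ξ| ^ 2) := by
  have hc : ContDiff ℝ ∞ (fun ξ : ℝ => (ψ (2 * Real.pi * ξ) : ℂ)) :=
    Complex.ofRealCLM.contDiff.comp (h.contDiff.comp (contDiff_const.mul contDiff_id))
  have hs : HasCompactSupport (fun ξ : ℝ => (ψ (2 * Real.pi * ξ) : ℂ)) :=
    (h.hasCompactSupport.comp_homeomorph
      (Homeomorph.mulLeft₀ (2 * Real.pi) (by positivity))).comp_left (g := fun r : ℝ => (r : ℂ)) rfl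
  set Φ : SchwartzMap ℝ ℂ := hs.toSchwartzMap hc with hΦ
  have hΦx : ∀ ξ, Φ ξ = (ψ (2 * Real.pi * ξ) : ℂ) := fun ξ => rfl
  have hΦe : ∀ ξ, Φ (-ξ) = Φ ξ := fun ξ => by rw [hΦx, hΦx, mul_neg, h.even]
  set k : SchwartzMap ℝ ℂ := 𝓕 Φ with hk
  have hkc : (k : ℝ → ℂ) = 𝓕 (Φ : ℝ → ℂ) := SchwartzMap.fourier_coe Φ
  have hinv : 𝓕⁻ (Φ : ℝ → ℂ) = 𝓕 (Φ : ℝ → ℂ) := by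
    rw [Real.fourierInv_eq_fourier_comp_neg, funext hΦe]
  -- Since `Φ` is real, conjugation turns its Fourier transform into the inverse transform. Since
  -- `Φ` is even, the two coincide.
  have hreal : ∀ z, ((k z).re : ℂ) = k z := fun z => by
    rw [← Complex.conj_eq_iff_re]
    have h1 : (starRingEnd ℂ) (𝓕 (Φ : ℝ → ℂ) z) = 𝓕⁻ (Φ : ℝ → ℂ) z := by
      rw [Real.fourier_eq', Real.fourierInv_eq', ← integral_conj]
      refine integral_congr_ae (.of_forall fun v => ?_)
      simp only [smul_eq_mul, map_mul, hΦx, Complex.conj_ofReal, ← Complex.exp_conj, Complex.conj_I]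
      congr 2
      push_cast
      ring
    rw [hkc, h1, hinv]
  have hKc : (fun z => ((k z).re : ℂ)) = k := funext hreal
  have hF : ∀ ξ, realFourier (fun z => (k z).re) ξ = Φ ξ := fun ξ => by
    rw [realFourier, hKc, hkc, fourier_fourier_schwartz, hΦe]
  have hmom : HasMoments (fun z => (k z).re) := fun n => by
    refine (k.integrable_pow_mul volume n).mono' ?_ (.of_forall fun z => ?_)
    · exact (Continuous.mul (by fun_prop)
        (Complex.continuous_re.comp k.continuous)).aestronglyMeasurable
    · rw [norm_mul, norm_pow]
      gcongr
      exact Complex.abs_re_le_norm _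
  have hd : ∀ ξ, deriv (Φ : ℝ → ℂ) ξ = (2 * Real.pi * deriv ψ (2 * Real.pi * ξ) : ℝ) := fun ξ => by
    have h1 : HasDerivAt ψ (deriv ψ (2 * Real.pi * ξ)) (2 * Real.pi * ξ) :=
      (h.contDiff.differentiable (by simp)).differentiableAt.hasDerivAt
    have h2 := h1.comp ξ ((hasDerivAt_id ξ).const_mul (2 * Real.pi))
    have h3 := h2.ofReal_comp
    refine (h3.congr_deriv ?_).deriv
    push_cast
    ring
  -- Multiplication by `z` is differentiation of the symbol divided by `2πi` up to sign. The factor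
  -- `2π` cancels against the chain rule for `ψ(2πξ)`.
  have hF' : ∀ ξ, ‖realFourier (fun z => z * (k z).re) ξ‖ = |deriv ψ (2 * Real.pi * ξ)| := fun ξ => by
    have h1 : (fun z : ℝ => ((z * (k z).re : ℝ) : ℂ)) =
        (2 * Real.pi * Complex.I : ℂ)⁻¹ • 𝓕 (deriv (Φ : ℝ → ℂ)) := by
      ext z
      have hne : (2 * Real.pi * Complex.I : ℂ) ≠ 0 := Complex.two_pi_I_ne_zero
      rw [Pi.smul_apply, Real.fourier_deriv Φ.integrable Φ.differentiable
        (by exact (SchwartzMap.derivCLM ℂ ℂ Φ).integrable)]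
      rw [Complex.ofReal_mul, hreal, ← hkc]
      simp only [smul_eq_mul]
      field_simp
    have h2 : 𝓕 (𝓕 (deriv (Φ : ℝ → ℂ))) ξ = deriv (Φ : ℝ → ℂ) (-ξ) :=
      fourier_fourier_schwartz (SchwartzMap.derivCLM ℂ ℂ Φ) ξ
    have h3 : 𝓕 ((2 * Real.pi * Complex.I : ℂ)⁻¹ • 𝓕 (deriv (Φ : ℝ → ℂ))) ξ =
        (2 * Real.pi * Complex.I : ℂ)⁻¹ • 𝓕 (𝓕 (deriv (Φ : ℝ → ℂ))) ξ := by
      rw [Real.fourier_eq, Real.fourier_eq, ← integral_smul]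
      refine integral_congr_ae (.of_forall fun v => ?_)
      simp only [Pi.smul_apply]
      rw [smul_comm]
    rw [realFourier, h1, h3, h2, hd, norm_smul, norm_inv, Complex.norm_real, norm_mul, norm_mul,
      Complex.norm_I, norm_mul, mul_neg, h.deriv_neg, norm_neg]
    simp only [Complex.norm_ofNat, Complex.norm_real, Real.norm_eq_abs, abs_of_pos Real.pi_pos,
      abs_mul, abs_two]
    field_simp
  refine ⟨fun z => (k z).re, (Complex.continuous_re.comp k.continuous).measurable, hmom, ?_,
    fun ξ => ?_⟩
  -- The mass of the kernel is its symbol at the origin, `ψ(0) = 1`.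
  · have h0 := hF 0
    rw [hΦx, mul_zero, h.zero, realFourier, Real.fourier_real_eq] at h0
    simp only [mul_zero, neg_zero, AddChar.map_zero_eq_one, one_smul] at h0
    rw [integral_complex_ofReal] at h0
    exact_mod_cast h0
  · rw [hF, ← ofReal_norm, ← ofReal_norm (realFourier _ _), hF', hΦx, Complex.norm_real,
      Real.norm_eq_abs, ← ENNReal.ofReal_pow (abs_nonneg _), ← ENNReal.ofReal_pow (abs_nonneg _),
      ← ENNReal.ofReal_add (by positivity) (by positivity), sq_abs, sq_abs, add_comm]
    congr 1
    rcases abs_choice (2 * Real.pi * ξ) with e | e <;> rw [e]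
    rw [h.even, h.deriv_neg, neg_sq]

/-! ### The one-dimensional profile problem -/

theorem integrableOn_Ioc_rpow {a : ℝ} (ha : -1 < a) {M : ℝ} (hM : 0 < M) :
    IntegrableOn (fun t : ℝ => t ^ a) (Ioc 0 M) := by
  rw [integrableOn_Ioc_iff_integrableOn_Ioo]
  exact (intervalIntegral.integrableOn_Ioo_rpow_iff hM).2 ha

theorem integrableOn_mul_rpow {a : ℝ} (ha : -1 < a) {g : ℝ → ℝ} (hg : Continuous g)
    (hs : HasCompactSupport g) : IntegrableOn (fun t => g t * t ^ a) (Ioi 0) := by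
  obtain ⟨C, hC⟩ := hs.exists_bound_of_continuous hg
  obtain ⟨M, hM⟩ := hs.isCompact.isBounded.subset_closedBall 0
  have h0 : ∀ t, max M 1 < t → g t = 0 := fun t ht => by
    refine image_eq_zero_of_notMem_tsupport fun hm => ?_
    have := hM hm
    rw [Real.closedBall_eq_Icc] at this
    linarith [this.2, le_max_left M 1]
  have hpos : 0 < max M 1 := lt_max_of_lt_right zero_lt_one
  have h1 : IntegrableOn (fun t => g t * t ^ a) (Ioc 0 (max M 1)) :=
    ((integrableOn_Ioc_rpow ha hpos).bdd_mul hg.aestronglyMeasurable.restrict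
      (.of_forall hC) :)
  have h2 : IntegrableOn (fun t => g t * t ^ a) (Ioi (max M 1)) :=
    integrableOn_zero.congr_fun (fun t ht => by simp [h0 t ht]) measurableSet_Ioi
  rw [← Ioc_union_Ioi_eq_Ioi hpos.le]
  exact h1.union h2

/-- The energy of a profile for the weight `t ^ a`. -/
noncomputable def profileEnergy (a : ℝ) (ψ : ℝ → ℝ) : ℝ :=
  ∫ t in Ioi 0, (deriv ψ t ^ 2 + ψ t ^ 2) * t ^ a

theorem SmoothProfile.continuous_deriv {ψ : ℝ → ℝ} (h : SmoothProfile ψ) : Continuous (deriv ψ) :=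
  h.contDiff.continuous_deriv (by simp)

theorem SmoothProfile.integrableOn {ψ : ℝ → ℝ} (h : SmoothProfile ψ) {a : ℝ} (ha : -1 < a) :
    IntegrableOn (fun t => (deriv ψ t ^ 2 + ψ t ^ 2) * t ^ a) (Ioi 0) := by
  refine integrableOn_mul_rpow ha
    ((h.continuous_deriv.pow 2).add (h.contDiff.continuous.pow 2)) ?_
  exact (h.hasCompactSupport.deriv.comp_left (g := fun r : ℝ => r ^ 2) (by simp)).add
    (h.hasCompactSupport.comp_left (g := fun r : ℝ => r ^ 2) (by simp))

theorem SmoothProfile.profileEnergy_mem {ψ : ℝ → ℝ} (h : SmoothProfile ψ) {a s : ℝ} (ha : -1 < a)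
    (hs : 1 - 2 * s = a) : profileEnergy a ψ ∈ profileEnergies s := by
  refine ⟨ψ, deriv ψ, h.contDiff.continuous.continuousOn, fun t _ =>
    (h.contDiff.differentiable (by simp)).differentiableAt.hasDerivAt, h.zero, ?_, ?_, ?_⟩
  · have := h.hasCompactSupport.is_zero_at_infty
    exact this.mono_left atTop_le_cocompact
  · rw [hs]; exact h.integrableOn ha
  · rw [hs]; rfl

theorem exists_smoothProfile : ∃ ψ, SmoothProfile ψ := by
  let χ : ContDiffBump (0 : ℝ) := ⟨1, 2, by norm_num, by norm_num⟩
  exact ⟨χ, χ.contDiff, fun t => χ.neg t, χ.hasCompactSupport, χ.one_of_mem_closedBall (by simpa using χ.rIn_pos.le)⟩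

/-- On `(0,1]` the weight is at least 1 because `s > 1/2`. Either `φ ≥ 1/2` there and `∫ φ² ≥ 1/4`,
or `φ` falls from 1 below 1/2; then `1/2 ≤ ∫ |φ'|`, and `|φ'| ≤ φ'² + 1/4` again leaves `1/4`. This
keeps the infimum strictly positive. -/
theorem quarter_le_of_mem_profileEnergies {s E : ℝ} (hs : 1 / 2 < s)
    (hE : E ∈ profileEnergies s) : 1 / 4 ≤ E := by
  obtain ⟨φ, φ', hcont, hderiv, h0, -, hint, rfl⟩ := hE
  set w : ℝ → ℝ := fun t => (φ' t ^ 2 + φ t ^ 2) * t ^ (1 - 2 * s) with hw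
  have hwn : ∀ t ∈ Ioi (0 : ℝ), 0 ≤ w t := fun t ht => by
    have : (0 : ℝ) ≤ t ^ (1 - 2 * s) := Real.rpow_nonneg (le_of_lt ht) _
    positivity
  have hge : ∀ t ∈ Ioc (0 : ℝ) 1, φ' t ^ 2 + φ t ^ 2 ≤ w t := fun t ht =>
    le_mul_of_one_le_right (by positivity)
      (Real.one_le_rpow_of_pos_of_le_one_of_nonpos ht.1 ht.2 (by linarith))
  have hw1 : IntegrableOn w (Ioc 0 1) := hint.mono_set Ioc_subset_Ioi_self
  have hle : ∫ t in Ioc 0 1, w t ≤ ∫ t in Ioi 0, w t :=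
    setIntegral_mono_set hint ((ae_restrict_iff' measurableSet_Ioi).2 (.of_forall hwn))
      Ioc_subset_Ioi_self.eventuallyLE
  refine le_trans ?_ hle
  by_cases hcase : ∀ t ∈ Ioc (0 : ℝ) 1, 1 / 2 ≤ φ t
  · calc (1 / 4 : ℝ) = ∫ t in Ioc (0 : ℝ) 1, (1 / 4 : ℝ) := by simp
      _ ≤ _ := by
        refine setIntegral_mono_on (by simp) hw1 measurableSet_Ioc fun t ht => ?_
        refine le_trans ?_ (hge t ht)
        nlinarith [hcase t ht, sq_nonneg (φ' t)]
  · push Not at hcase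
    obtain ⟨t, ht, hlt⟩ := hcase
    have hmeas : AEStronglyMeasurable φ' (volume.restrict (Ioc 0 1)) := by
      refine (measurable_deriv φ).aestronglyMeasurable.congr ?_
      refine (ae_restrict_iff' measurableSet_Ioc).2 (.of_forall fun x hx => (hderiv x hx.1).deriv)
    have hbd : ∀ x ∈ Ioc (0 : ℝ) 1, |φ' x| ≤ w x + 1 / 4 := fun x hx => by
      have := hge x hx
      nlinarith [sq_nonneg (|φ' x| - 1 / 2), sq_abs (φ' x), sq_nonneg (φ x)]
    have hw4 : IntegrableOn (fun x => w x + 1 / 4) (Ioc 0 1) :=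
      Integrable.add hw1 (by simp)
    have hφ' : IntegrableOn φ' (Ioc 0 1) := hw4.mono' hmeas
      ((ae_restrict_iff' measurableSet_Ioc).2 (.of_forall hbd))
    have hsub : Ioc 0 t ⊆ Ioc 0 1 := Ioc_subset_Ioc_right ht.2
    have hftc : ∫ x in (0 : ℝ)..t, φ' x = φ t - φ 0 :=
      intervalIntegral.integral_eq_sub_of_hasDerivAt_of_le ht.1.le
        (hcont.mono Icc_subset_Ici_self) (fun x hx => hderiv x hx.1)
        ((intervalIntegrable_iff_integrableOn_Ioc_of_le ht.1.le).2 (hφ'.mono_set hsub))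
    have h1 : 1 / 2 ≤ ∫ x in Ioc 0 1, |φ' x| := by
      calc (1 / 2 : ℝ) ≤ |∫ x in (0 : ℝ)..t, φ' x| := by
            rw [hftc, h0, abs_sub_comm]
            exact le_trans (by linarith) (le_abs_self _)
        _ ≤ ∫ x in Ioc 0 t, |φ' x| := by
            rw [intervalIntegral.integral_of_le ht.1.le]
            exact norm_integral_le_integral_norm φ'
        _ ≤ _ := setIntegral_mono_set hφ'.abs (.of_forall fun _ => abs_nonneg _)
            hsub.eventuallyLE
    have h2 : ∫ x in Ioc 0 1, |φ' x| ≤ ∫ x in Ioc 0 1, (w x + 1 / 4) :=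
      setIntegral_mono_on hφ'.abs hw4 measurableSet_Ioc hbd
    rw [integral_add hw1 (by simp)] at h2
    simp only [integral_const, MeasurableSet.univ, measureReal_restrict_apply, univ_inter,
      Real.volume_real_Ioc, smul_eq_mul] at h2
    norm_num at h2
    linarith

theorem profileEnergies_bddBelow {s : ℝ} (hs : 1 / 2 < s) : BddBelow (profileEnergies s) :=
  ⟨1 / 4, fun _ hE => quarter_le_of_mem_profileEnergies hs hE⟩

theorem profileEnergies_nonempty {s : ℝ} (hs1 : s < 1) : (profileEnergies s).Nonempty := by
  obtain ⟨ψ, hψ⟩ := exists_smoothProfile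
  exact ⟨_, hψ.profileEnergy_mem (by linarith : -1 < 1 - 2 * s) rfl⟩

theorem profileMin_pos {s : ℝ} (hs : 1 / 2 < s) (hs1 : s < 1) : 0 < profileMin s :=
  lt_of_lt_of_le (by norm_num : (0 : ℝ) < 1 / 4) (le_csInf (profileEnergies_nonempty hs1)
    fun _ hE => quarter_le_of_mem_profileEnergies hs hE)

/-! ### Smoothing of admissible profiles -/

/-- A smooth contraction of the line that is locally constant near `0` and near `1`. -/
theorem exists_contraction {c : ℝ} (hc : 0 < c) (hc8 : c < 1 / 8) :
    ∃ T χ : ℝ → ℝ, Continuous χ ∧ (∀ x, HasDerivAt T (χ x) x) ∧ (∀ x, |χ x| ≤ 1) ∧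
      (∀ x, x ≤ c → χ x = 0) ∧ (∀ x, 1 - c ≤ x → χ x = 0) ∧ (∀ x, x ≤ c → T x = 0) ∧
      (∀ x, 1 - c ≤ x → T x = T 1) ∧ (∀ x, |T x| ≤ |x|) ∧ 1 - 4 * c ≤ T 1 := by
  -- The bump is 1 on `[2c, 1 - 2c]` and 0 outside `(c, 1 - c)`, so its integral over `[0,1]` is at
  -- least `1 - 4c`.
  let χ : ContDiffBump (1 / 2 : ℝ) := ⟨1 / 2 - 2 * c, 1 / 2 - c, by linarith, by linarith⟩
  have hχc : Continuous χ := χ.continuous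
  have hlow : ∀ x, x ≤ c → χ x = 0 := fun x hx => χ.zero_of_le_dist (by
    change 1 / 2 - c ≤ _
    rw [Real.dist_eq, abs_sub_comm]
    exact le_trans (by linarith) (le_abs_self _))
  have hhigh : ∀ x, 1 - c ≤ x → χ x = 0 := fun x hx => χ.zero_of_le_dist (by
    change 1 / 2 - c ≤ _
    rw [Real.dist_eq]
    exact le_trans (by linarith) (le_abs_self _))
  have hone : ∀ x, |χ x| ≤ 1 := fun x => by rw [abs_of_nonneg χ.nonneg]; exact χ.le_one
  have hi : ∀ u v, IntervalIntegrable χ volume u v := fun u v => hχc.intervalIntegrable u v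
  refine ⟨fun x => ∫ t in (0 : ℝ)..x, χ t, χ, hχc, hasDerivAt_primitive hχc 0, hone, hlow, hhigh,
    fun x hx => ?_, fun x hx => ?_, fun x => ?_, ?_⟩
  · refine intervalIntegral.integral_zero_ae (.of_forall fun t ht => hlow t ?_)
    exact (ht.2.trans (max_le hc.le hx))
  · have h := intervalIntegral.integral_add_adjacent_intervals (hi 0 1) (hi 1 x)
    have h2 : ∫ t in (1 : ℝ)..x, χ t = 0 :=
      intervalIntegral.integral_zero_ae (.of_forall fun t ht => hhigh t
        ((le_min (by linarith) hx).trans ht.1.le))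
    rw [h2, add_zero] at h
    exact h.symm
  · have := intervalIntegral.norm_integral_le_of_norm_le_const (a := 0) (b := x) (C := 1)
      (f := χ) fun t _ => hone t
    simpa using this
  · have h1 : ∫ t in (2 * c)..(1 - 2 * c), χ t ≤ ∫ t in (0 : ℝ)..1, χ t :=
      intervalIntegral.integral_mono_interval (by linarith) (by linarith) (by linarith)
        (.of_forall fun t => χ.nonneg) (hi _ _)
    have h2 : ∫ t in (2 * c)..(1 - 2 * c), χ t = ∫ t in (2 * c)..(1 - 2 * c), (1 : ℝ) := by
      refine intervalIntegral.integral_congr fun t ht => ?_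
      rw [uIcc_of_le (by linarith)] at ht
      refine χ.one_of_mem_closedBall ?_
      change dist t (1 / 2) ≤ 1 / 2 - 2 * c
      rw [Real.dist_eq, abs_le]
      exact ⟨by linarith [ht.1], by linarith [ht.2]⟩
    rw [h2, intervalIntegral.integral_const, smul_eq_mul, mul_one] at h1
    linarith

theorem integral_sq_le_of_eLpNorm_le {g : ℝ → ℝ} (hg : MemLp g 2 volume) {η : ℝ} (hη : 0 ≤ η)
    (hle : eLpNorm g 2 volume ≤ ENNReal.ofReal η) : ∫ t, g t ^ 2 ≤ η ^ 2 := by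
  have h1 : eLpNorm g 2 volume ^ (2 : ℕ) = ∫⁻ x, ‖g x‖ₑ ^ 2 := by
    have := eLpNorm_nnreal_pow_eq_lintegral (p := 2) (f := g) (μ := (volume : Measure ℝ)) (by simp)
    simpa using this
  have h2 : ∀ x, ENNReal.ofReal (g x ^ 2) = ‖g x‖ₑ ^ 2 := fun x => by
    rw [← sq_abs, ENNReal.ofReal_pow (abs_nonneg _), ← Real.norm_eq_abs, ofReal_norm]
  rw [integral_eq_lintegral_of_nonneg_ae (.of_forall fun t => sq_nonneg _)
    (hg.aestronglyMeasurable.pow 2)]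
  refine ENNReal.toReal_le_of_le_ofReal (by positivity) ?_
  simp_rw [h2]
  rw [← h1, ENNReal.ofReal_pow hη]
  exact pow_le_pow_left' hle 2

/-- The gap between the two sides is a multiple of a square. In the smoothing argument, a factor
close to 1 stays on the original energy and the large factor falls on an error made small
afterwards. -/
theorem add_sq_le_weighted {θ : ℝ} (hθ : 0 < θ) (x y : ℝ) :
    y ^ 2 ≤ (1 + θ) * x ^ 2 + (1 + θ⁻¹) * (y - x) ^ 2 := by
  have h : (1 + θ) * x ^ 2 + (1 + θ⁻¹) * (y - x) ^ 2 - y ^ 2 = θ⁻¹ * (θ * x - (y - x)) ^ 2 := by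
    field_simp
    ring
  have : 0 ≤ θ⁻¹ * (θ * x - (y - x)) ^ 2 := by positivity
  linarith

/-- A smooth function of `|t|` obtained by reflecting a function constant near the origin. -/
theorem smoothProfile_of_primitive {p h : ℝ → ℝ} {m M : ℝ} (hm : 0 < m) (hp : ContDiff ℝ ∞ p)
    (hd : ∀ t, HasDerivAt p (h t) t) (hconst : ∀ t, t ≤ m → p t = p 0)
    (hM : ∀ t, M ≤ t → p t = 0) (h0 : 0 < p 0) (a : ℝ) :
    ∃ ψ, SmoothProfile ψ ∧
      profileEnergy a ψ = (∫ t in Ioi 0, (h t ^ 2 + p t ^ 2) * t ^ a) / p 0 ^ 2 := by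
  have hsm : ContDiff ℝ ∞ fun t => p |t| / p 0 := by
    refine contDiff_iff_contDiffAt.2 fun t => ?_
    -- The corner of `|t|` at 0 does no harm, because `p` is constant on `(-∞, m]`.
    rcases eq_or_ne t 0 with rfl | ht
    · refine (contDiffAt_const (c := (1 : ℝ))).congr_of_eventuallyEq ?_
      filter_upwards [Ioo_mem_nhds (neg_lt_zero.2 hm) hm] with t ht
      rw [hconst _ (abs_le.2 ⟨ht.1.le, ht.2.le⟩), div_self h0.ne']
    · exact (hp.contDiffAt.comp t (contDiffAt_abs ht)).div_const _
  refine ⟨fun t => p |t| / p 0, ⟨hsm, fun t => by rw [abs_neg], ?_, by simp [h0.ne']⟩, ?_⟩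
  · refine .intro (isCompact_Icc (a := -M) (b := M)) fun t ht => ?_
    have : M ≤ |t| := by
      by_contra! hlt
      exact ht ⟨(abs_lt.1 hlt).1.le, (abs_lt.1 hlt).2.le⟩
    simp [hM _ this]
  · rw [profileEnergy, ← integral_div]
    refine setIntegral_congr_fun measurableSet_Ioi fun t ht => ?_
    have ht0 : (0 : ℝ) < t := ht
    have hder : deriv (fun t => p |t| / p 0) t = h t / p 0 := by
      refine HasDerivAt.deriv (((hd t).div_const (p 0)).congr_of_eventuallyEq ?_)
      filter_upwards [Ioi_mem_nhds ht0] with y hy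
      rw [abs_of_pos hy]
    simp only [hder, abs_of_pos ht0]
    field_simp

/-- Truncated profiles can be smoothed with a small change of the energy. -/
theorem exists_smoothProfile_energy_le_of_trunc {a : ℝ} (ha : -1 < a) (ha0 : a < 0)
    {φ φ' : ℝ → ℝ} (hcont : ContinuousOn φ (Ici 0)) (hderiv : ∀ t, 0 < t → HasDerivAt φ (φ' t) t)
    (h0 : φ 0 = 1) (hlim : Tendsto φ atTop (𝓝 0))
    (hint : IntegrableOn (fun t => (φ' t ^ 2 + φ t ^ 2) * t ^ a) (Ioi 0))
    {c : ℝ} (hc : 0 < c) (hc8 : c < 1 / 8) :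
    ∃ ψ, SmoothProfile ψ ∧ profileEnergy a ψ ≤
      ((1 + c) * (∫ t in Ioi 0, (φ' t ^ 2 + φ t ^ 2) * t ^ a) + c) / (1 - 5 * c) ^ 2 := by
  obtain ⟨T, χ, hχc, hTd, hχ1, hχl, hχh, hTl, hTh, hTle, hT1⟩ := exists_contraction hc hc8
  -- the range where the truncation acts
  obtain ⟨δ, hδ, hδφ⟩ : ∃ δ, 0 < δ ∧ ∀ t, 0 ≤ t → t < δ → 1 - c ≤ φ t := by
    have h1 : ∀ᶠ t in 𝓝[≥] (0 : ℝ), 1 - c < φ t :=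
      (hcont 0 self_mem_Ici).eventually_const_lt (by rw [h0]; linarith)
    obtain ⟨δ, hδ, hsub⟩ := mem_nhdsGE_iff_exists_Ico_subset.1 h1
    exact ⟨δ, hδ, fun t ht0 ht => le_of_lt (hsub ⟨ht0, ht⟩)⟩
  obtain ⟨R, hRδ, hRφ⟩ : ∃ R, δ ≤ R ∧ ∀ t, R ≤ t → φ t ≤ c := by
    obtain ⟨R, hR⟩ := eventually_atTop.1 (hlim.eventually_lt_const hc)
    exact ⟨max R δ, le_max_right _ _, fun t ht => (hR t ((le_max_left _ _).trans ht)).le⟩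
  have hR0 : 0 < R := hδ.trans_le hRδ
  -- On the positive axis `f` is the derivative of `T ∘ φ`. It vanishes off `[δ, R]`, because `φ` is
  -- close to 1 before `δ` and at most `c` after `R`, where `T` is constant.
  set f : ℝ → ℝ := indicator (Ioi 0) fun t => χ (φ t) * φ' t with hf
  have hfpos : ∀ t, 0 < t → f t = χ (φ t) * φ' t := fun t ht => indicator_of_mem ht _
  have hf0 : ∀ t, t ∉ Icc δ R → f t = 0 := fun t ht => by
    rcases le_or_gt t 0 with h | h
    · exact indicator_of_notMem (not_lt.2 h) _
    · rw [hfpos t h]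
      rcases lt_or_ge t δ with h1 | h1
      · rw [hχh _ (hδφ t h.le h1), zero_mul]
      · have : R < t := by by_contra! h2; exact ht ⟨h1, h2⟩
        rw [hχl _ (hRφ t this.le), zero_mul]
  have hfsq : ∀ t, 0 < t → f t ^ 2 ≤ φ' t ^ 2 := fun t ht => by
    rw [hfpos t ht, mul_pow]
    refine mul_le_of_le_one_left (sq_nonneg _) ?_
    rw [← sq_abs]
    exact pow_le_one₀ (abs_nonneg _) (hχ1 _)
  have hfmeas : AEStronglyMeasurable f volume := by
    rw [hf, aestronglyMeasurable_indicator_iff measurableSet_Ioi]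
    refine AEStronglyMeasurable.mul ?_ ?_
    · exact (hχc.comp_continuousOn (hcont.mono Ioi_subset_Ici_self)).aestronglyMeasurable
        measurableSet_Ioi
    · refine (measurable_deriv φ).aestronglyMeasurable.congr ?_
      exact (ae_restrict_iff' measurableSet_Ioi).2 (.of_forall fun x hx => (hderiv x hx).deriv)
  have hfL : MemLp f 2 volume := by
    rw [memLp_two_iff_integrable_sq hfmeas]
    have hsupp : Function.support (fun t => f t ^ 2) ⊆ Icc δ R := fun t ht => by
      by_contra h
      exact ht (by simp [hf0 t h])
    rw [← integrableOn_iff_integrable_of_support_subset hsupp]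
    -- As `a < 0`, the weight is at least `R^a` on `[δ, R]`, so finite weighted energy gives `f ∈
    -- L²` without weight.
    have hI : IntegrableOn (fun t => (R ^ a)⁻¹ * ((φ' t ^ 2 + φ t ^ 2) * t ^ a)) (Icc δ R) :=
      (hint.mono_set fun t ht => hδ.trans_le ht.1).const_mul _
    refine hI.mono' (hfmeas.pow 2).restrict
      ((ae_restrict_iff' measurableSet_Icc).2 (.of_forall fun t ht => ?_))
    have ht0 : 0 < t := hδ.trans_le ht.1
    have hRa : 0 < R ^ a := Real.rpow_pos_of_pos hR0 a
    have : R ^ a ≤ t ^ a := Real.rpow_le_rpow_of_nonpos ht0 ht.2 ha0.le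
    rw [Real.norm_of_nonneg (sq_nonneg _), inv_mul_eq_div, le_div_iff₀ hRa]
    calc f t ^ 2 * R ^ a ≤ φ' t ^ 2 * t ^ a :=
          mul_le_mul (hfsq t ht0) this hRa.le (sq_nonneg _)
      _ ≤ _ := by
          have : 0 < t ^ a := Real.rpow_pos_of_pos ht0 a
          gcongr
          linarith [sq_nonneg (φ t)]
  -- smoothing of the derivative
  set M := R + δ / 2 with hMdef
  have hM0 : 0 < M := by positivity
  set B := ∫ t in Ioc 0 M, t ^ a with hB
  -- The first bound makes the primitives uniformly `c`-close; the second bounds the whole error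
  -- term in the energy comparison by `c`.
  obtain ⟨η, hη, hη1, hη2⟩ : ∃ η : ℝ, 0 < η ∧ η * √(M - δ / 2) < c ∧
      (1 + c⁻¹) * ((δ / 2) ^ a * η ^ 2 + (η * √(M - δ / 2)) ^ 2 * B) < c := by
    have h1 : Tendsto (fun η : ℝ => η * √(M - δ / 2)) (𝓝[>] 0) (𝓝 (0 * √(M - δ / 2))) :=
      (Continuous.tendsto (by fun_prop) 0).mono_left nhdsWithin_le_nhds
    have h2 : Tendsto (fun η : ℝ => (1 + c⁻¹) * ((δ / 2) ^ a * η ^ 2 +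
        (η * √(M - δ / 2)) ^ 2 * B)) (𝓝[>] 0) (𝓝 ((1 + c⁻¹) * ((δ / 2) ^ a * 0 ^ 2 +
        (0 * √(M - δ / 2)) ^ 2 * B))) :=
      (Continuous.tendsto (by fun_prop) 0).mono_left nhdsWithin_le_nhds
    have h3 := h1.eventually_lt_const (u := c) (by simpa using hc)
    have h4 := h2.eventually_lt_const (u := c) (by simpa using hc)
    have h5 : ∀ᶠ η in 𝓝[>] (0 : ℝ), 0 < η := self_mem_nhdsWithin
    obtain ⟨η, hη⟩ := (h5.and (h3.and h4)).exists
    exact ⟨η, hη⟩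
  obtain ⟨h, hh, hh0, hhf⟩ := exists_contDiff_eLpNorm_sub_le hfL hRδ hf0 (half_pos hδ) hη
  have hδ2 : δ - δ / 2 = δ / 2 := by ring
  rw [hδ2, ← hMdef] at hh0
  have hδM : δ / 2 ≤ M := by linarith
  have hhL : MemLp h 2 volume :=
    hh.continuous.memLp_of_hasCompactSupport (hasCompactSupport_of_Icc hh0)
  have hdL : MemLp (fun t => h t - f t) 2 volume := hhL.sub hfL
  have hd0 : ∀ t, t ∉ Icc (δ / 2) M → h t - f t = 0 := fun t ht => by
    rw [hh0 t ht, hf0 t fun hm => ht ⟨by linarith [hm.1], by linarith [hm.2]⟩, sub_zero]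
  obtain ⟨hdi, hd1⟩ := integral_abs_le_of_eLpNorm_le hdL hδM hd0 hη.le hhf
  have hd2 := integral_sq_le_of_eLpNorm_le hdL hη.le hhf
  have hfi : Integrable f :=
    (integral_abs_le_of_eLpNorm_le hfL hRδ hf0 (ENNReal.toReal_nonneg (a := eLpNorm f 2 volume))
      (ENNReal.ofReal_toReal hfL.eLpNorm_ne_top).ge).1
  set p : ℝ → ℝ := fun t => ∫ r in M..t, h r with hp
  -- Integrating from `M` makes both primitives vanish beyond `M`, so their distance is at most the
  -- `L¹` norm of `h - f`.
  have hTφd : ∀ t, 0 < t → HasDerivAt (fun t => T (φ t)) (f t) t := fun t ht => by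
    rw [hfpos t ht]
    exact (hTd (φ t)).comp t (hderiv t ht)
  have hTM : T (φ M) = 0 := hTl _ (hRφ M (by linarith))
  have hTφ : ∀ t, 0 < t → T (φ t) = ∫ r in M..t, f r := fun t ht => by
    rw [intervalIntegral.integral_eq_sub_of_hasDerivAt
      (fun r hr => hTφd r (lt_of_lt_of_le (lt_min hM0 ht) hr.1)) hfi.intervalIntegrable, hTM,
      sub_zero]
  have hclose : ∀ t, 0 < t → |p t - T (φ t)| ≤ η * √(M - δ / 2) := fun t ht => by
    rw [hTφ t ht, hp, ← intervalIntegral.integral_sub (hh.continuous.intervalIntegrable _ _)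
      hfi.intervalIntegrable]
    exact (abs_intervalIntegral_le hdi _ _).trans hd1
  have hpM : ∀ t, M ≤ t → p t = 0 := fun t ht => by
    rw [hp]
    refine intervalIntegral.integral_zero_ae ?_
    filter_upwards [Measure.ae_ne volume M] with r hr hrm
    rw [uIoc_of_le ht] at hrm
    exact hh0 r fun hm => hrm.1.not_ge hm.2
  have hpconst' : ∀ t, t ≤ δ / 2 → p t = p (δ / 2) := fun t ht => by
    have h1 := intervalIntegral.integral_add_adjacent_intervals
      (hh.continuous.intervalIntegrable (μ := volume) M t)
      (hh.continuous.intervalIntegrable t (δ / 2))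
    have h2 : ∫ r in t..(δ / 2), h r = 0 := by
      refine intervalIntegral.integral_zero_ae ?_
      filter_upwards [Measure.ae_ne volume (δ / 2)] with r hr hrm
      rw [uIoc_of_le ht] at hrm
      exact hh0 r fun hm => hr (le_antisymm hrm.2 hm.1)
    rw [h2, add_zero] at h1
    exact h1
  have hpconst : ∀ t, t ≤ δ / 2 → p t = p 0 := fun t ht => by
    rw [hpconst' t ht, hpconst' 0 (by positivity)]
  -- The loss `5c` is `4c` from `T 1` and `c` from the uniform error.
  have hp0 : 1 - 5 * c ≤ p 0 := by
    have h1 := hclose (δ / 2) (by positivity)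
    rw [hTh _ (hδφ _ (by positivity) (by linarith)), hpconst _ le_rfl] at h1
    linarith [neg_abs_le (p 0 - T 1)]
  have hp0pos : 0 < p 0 := lt_of_lt_of_le (by linarith) hp0
  obtain ⟨ψ, hψ, hEψ⟩ := smoothProfile_of_primitive (half_pos hδ) (contDiff_primitive hh M)
    (hasDerivAt_primitive hh.continuous M) hpconst hpM hp0pos a
  refine ⟨ψ, hψ, ?_⟩
  rw [hEψ]
  -- comparison of the energies
  set E := ∫ t in Ioi 0, (φ' t ^ 2 + φ t ^ 2) * t ^ a with hE
  set G : ℝ → ℝ := fun t => (1 + c) * ((φ' t ^ 2 + φ t ^ 2) * t ^ a) + (1 + c⁻¹) *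
    ((δ / 2) ^ a * (h t - f t) ^ 2 +
      (η * √(M - δ / 2)) ^ 2 * indicator (Ioc 0 M) (fun t => t ^ a) t) with hG
  have hsqi : Integrable (fun t => (h t - f t) ^ 2) := hdL.integrable_sq
  have hwi : Integrable (indicator (Ioc 0 M) fun t : ℝ => t ^ a) :=
    (integrableOn_Ioc_rpow ha hM0).integrable_indicator measurableSet_Ioc
  have hi2 : IntegrableOn (fun t => (δ / 2) ^ a * (h t - f t) ^ 2 +
      (η * √(M - δ / 2)) ^ 2 * indicator (Ioc 0 M) (fun t => t ^ a) t) (Ioi 0) :=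
    ((hsqi.const_mul _).add (hwi.const_mul _)).integrableOn
  have hGi : IntegrableOn G (Ioi 0) := (hint.const_mul _).add (hi2.const_mul _)
  have hpt : ∀ t ∈ Ioi (0 : ℝ), (h t ^ 2 + p t ^ 2) * t ^ a ≤ G t := fun t ht => by
    have ht0 : (0 : ℝ) < t := ht
    have hta : 0 < t ^ a := Real.rpow_pos_of_pos ht0 a
    have h1 := add_sq_le_weighted hc (f t) (h t)
    have h2 := add_sq_le_weighted hc (T (φ t)) (p t)
    have h3 : T (φ t) ^ 2 ≤ φ t ^ 2 := sq_le_sq.2 (hTle _)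
    -- The error in the derivative vanishes below `δ/2`, away from the singularity of the weight.
    have h4 : (h t - f t) ^ 2 * t ^ a ≤ (δ / 2) ^ a * (h t - f t) ^ 2 := by
      by_cases hm : t ∈ Icc (δ / 2) M
      · rw [mul_comm]
        gcongr ?_ * _
        exact Real.rpow_le_rpow_of_nonpos (half_pos hδ) hm.1 ha0.le
      · simp [hd0 t hm]
    -- The error in the function reaches down to 0, but it is uniformly small and the weight is
    -- integrable on `(0, M]`.
    have h5 : (p t - T (φ t)) ^ 2 * t ^ a ≤
        (η * √(M - δ / 2)) ^ 2 * indicator (Ioc 0 M) (fun t => t ^ a) t := by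
      by_cases hm : t ∈ Ioc 0 M
      · rw [indicator_of_mem hm]
        gcongr ?_ * _
        rw [← sq_abs]
        exact pow_le_pow_left₀ (abs_nonneg _) (hclose t ht0) 2
      · have : M < t := by by_contra! h2; exact hm ⟨ht0, h2⟩
        rw [indicator_of_notMem hm, hpM t this.le, hTl _ (hRφ t (by linarith))]
        simp
    have h6 : 0 < 1 + c⁻¹ := by positivity
    calc (h t ^ 2 + p t ^ 2) * t ^ a
        ≤ ((1 + c) * (φ' t ^ 2 + φ t ^ 2) +
            (1 + c⁻¹) * ((h t - f t) ^ 2 + (p t - T (φ t)) ^ 2)) * t ^ a := by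
          refine mul_le_mul_of_nonneg_right ?_ hta.le
          have h7 := mul_le_mul_of_nonneg_left (add_le_add (hfsq t ht0) h3)
            (by positivity : 0 ≤ 1 + c)
          linarith
      _ = (1 + c) * ((φ' t ^ 2 + φ t ^ 2) * t ^ a) +
          (1 + c⁻¹) * ((h t - f t) ^ 2 * t ^ a + (p t - T (φ t)) ^ 2 * t ^ a) := by ring
      _ ≤ G t := by
          simp only [hG]
          gcongr
  have hIG : ∫ t in Ioi 0, (h t ^ 2 + p t ^ 2) * t ^ a ≤ ∫ t in Ioi 0, G t := by
    refine integral_mono_of_nonneg ?_ hGi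
      ((ae_restrict_iff' measurableSet_Ioi).2 (.of_forall hpt))
    refine (ae_restrict_iff' measurableSet_Ioi).2 (.of_forall fun t ht => ?_)
    have : 0 < t ^ a := Real.rpow_pos_of_pos ht a
    simp only [Pi.zero_apply]
    positivity
  have hGval : ∫ t in Ioi 0, G t ≤ (1 + c) * E + c := by
    have e1 : ∫ t in Ioi 0, G t = (1 + c) * E + (1 + c⁻¹) * ((δ / 2) ^ a *
        (∫ t in Ioi 0, (h t - f t) ^ 2) + (η * √(M - δ / 2)) ^ 2 * B) := by
      simp only [hG]
      rw [integral_add (hint.const_mul _) (hi2.const_mul _), integral_const_mul,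
        integral_const_mul, integral_add (hsqi.const_mul _).integrableOn
        (hwi.const_mul _).integrableOn, integral_const_mul, integral_const_mul,
        setIntegral_indicator measurableSet_Ioc, inter_eq_right.2 Ioc_subset_Ioi_self]
    have e2 : ∫ t in Ioi 0, (h t - f t) ^ 2 ≤ η ^ 2 :=
      (setIntegral_le_integral hsqi (.of_forall fun _ => sq_nonneg _)).trans hd2
    rw [e1]
    have h6 : 0 < 1 + c⁻¹ := by positivity
    have h7 : 0 < (δ / 2) ^ a := Real.rpow_pos_of_pos (half_pos hδ) a
    have e3 : (1 + c⁻¹) * ((δ / 2) ^ a * (∫ t in Ioi 0, (h t - f t) ^ 2) +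
        (η * √(M - δ / 2)) ^ 2 * B) ≤
        (1 + c⁻¹) * ((δ / 2) ^ a * η ^ 2 + (η * √(M - δ / 2)) ^ 2 * B) := by gcongr
    linarith
  have hnum : 0 ≤ (1 + c) * E + c := by
    have : 0 ≤ E := setIntegral_nonneg measurableSet_Ioi fun t ht => by
      have : 0 < t ^ a := Real.rpow_pos_of_pos ht a
      positivity
    positivity
  have h15 : 0 < 1 - 5 * c := by linarith
  exact div_le_div₀ hnum (hIG.trans hGval) (by positivity) (by gcongr)

/-- Smooth even profiles with compact support have energies close to the minimal one. -/
theorem exists_smoothProfile_energy_lt {a s : ℝ} (ha : -1 < a) (ha0 : a < 0) (hs : 1 - 2 * s = a)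
    {η : ℝ} (hη : 0 < η) : ∃ ψ, SmoothProfile ψ ∧ profileMin s ≤ profileEnergy a ψ ∧
      profileEnergy a ψ < profileMin s + η := by
  obtain ⟨E, hE, hlt⟩ := exists_lt_of_csInf_lt (profileEnergies_nonempty (by linarith))
    (lt_add_of_pos_right (profileMin s) hη)
  obtain ⟨φ, φ', hcont, hderiv, h0, hlim, hint, hEq⟩ := hE
  rw [hs] at hint hEq
  have h1 : Tendsto (fun c : ℝ => ((1 + c) * E + c) / (1 - 5 * c) ^ 2) (𝓝[>] 0)
      (𝓝 (((1 + 0) * E + 0) / (1 - 5 * 0) ^ 2)) := by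
    refine Tendsto.mono_left (ContinuousAt.tendsto ?_) nhdsWithin_le_nhds
    exact ContinuousAt.div (by fun_prop) (by fun_prop) (by norm_num)
  have h2 := h1.eventually_lt_const (u := profileMin s + η) (by simpa using hlt)
  have h3 : ∀ᶠ c in 𝓝[>] (0 : ℝ), c ∈ Ioo (0 : ℝ) (1 / 8) := Ioo_mem_nhdsGT (by norm_num)
  obtain ⟨c, hc, hc8⟩ := (h2.and h3).exists
  obtain ⟨ψ, hψ, hle⟩ := exists_smoothProfile_energy_le_of_trunc ha ha0 hcont hderiv h0 hlim hint
    hc8.1 hc8.2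
  rw [← hEq] at hle
  exact ⟨ψ, hψ, csInf_le (profileEnergies_bddBelow (by linarith)) (hψ.profileEnergy_mem ha hs),
    hle.trans_lt hc⟩

/-! ### Scaling and exhaustion of the domains -/

theorem layerWidth_pos (a : ℝ) {ε : ℝ} (hε : 0 < ε) : 0 < layerWidth a ε := Real.rpow_pos_of_pos hε _

/-- This identity is the reason for the choice of `Λ_ε`: both energies scale like `Λ^a`, so the
prefactor `ε^{1-a}` exactly compensates. -/
theorem rpow_mul_layerWidth_rpow {a ε : ℝ} (ha0 : a < 0) (hε : 0 < ε) :
    ε ^ (1 - a) * layerWidth a ε ^ a = 1 := by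
  rw [layerWidth, ← Real.rpow_mul hε.le, ← Real.rpow_add hε]
  have : (1 - a) + (1 - a) / (-a) * a = 0 := by
    field_simp [ha0.ne]
    ring
  rw [this, Real.rpow_zero]

theorem tendsto_layerWidth {a : ℝ} (ha0 : a < 0) :
    Tendsto (layerWidth a) (𝓝[>] 0) (𝓝[>] 0) := by
  have hpos : 0 < (1 - a) / (-a) := div_pos (by linarith) (by linarith)
  refine tendsto_nhdsWithin_iff.2 ⟨?_, ?_⟩
  · have := (Real.continuousAt_rpow_const 0 _ (Or.inr hpos.le)).tendsto
    rw [Real.zero_rpow hpos.ne'] at this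
    exact this.mono_left nhdsWithin_le_nhds
  · filter_upwards [self_mem_nhdsWithin] with ε hε using layerWidth_pos a hε

theorem ramp_eq_comp_inv_mul (l x : ℝ) : ramp l x = ramp 1 (l⁻¹ * x) := by
  rw [ramp, ramp, div_one, div_eq_inv_mul]

theorem rampDeriv_eq_comp_inv_mul {l : ℝ} (hl : 0 < l) (x : ℝ) :
    rampDeriv l x = l⁻¹ * rampDeriv 1 (l⁻¹ * x) := by
  have : x ∈ Ioo (-l / 2) (l / 2) ↔ l⁻¹ * x ∈ Ioo (-1 / 2 : ℝ) (1 / 2) := by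
    rw [mem_Ioo, mem_Ioo, inv_mul_eq_div, lt_div_iff₀ hl, div_lt_iff₀ hl]
    constructor <;> rintro ⟨h1, h2⟩ <;> constructor <;> linarith
  by_cases hx : x ∈ Ioo (-l / 2) (l / 2)
  · rw [rampDeriv, rampDeriv, indicator_of_mem hx, indicator_of_mem (this.1 hx), inv_one, mul_one]
  · rw [rampDeriv, rampDeriv, indicator_of_notMem hx, indicator_of_notMem (mt this.2 hx), mul_zero]

theorem kernelExt_rampDeriv (K : ℝ → ℝ) {l : ℝ} (hl : 0 < l) (p : ℝ × ℝ) :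
    kernelExt K (rampDeriv l) p = l⁻¹ * kernelExt K (rampDeriv 1) (l⁻¹ • p) := by
  rw [kernelExt, kernelExt, ← integral_const_mul]
  refine integral_congr_ae (.of_forall fun z => ?_)
  simp only [rampDeriv_eq_comp_inv_mul hl (p.1 - p.2 * z), Prod.smul_fst, Prod.smul_snd,
    smul_eq_mul]
  rw [show l⁻¹ * (p.1 - p.2 * z) = l⁻¹ * p.1 - l⁻¹ * p.2 * z by ring]
  ring

theorem gagliardoIntegrand_ramp (s : ℝ) {l : ℝ} (hl : 0 < l) (q : ℝ × ℝ) :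
    gagliardoIntegrand s (ramp l) q =
      l ^ (-(1 + 2 * s)) * gagliardoIntegrand s (ramp 1) (l⁻¹ • q) := by
  simp only [gagliardoIntegrand, ramp_eq_comp_inv_mul l, Prod.smul_fst, Prod.smul_snd, smul_eq_mul]
  rw [← mul_sub, abs_mul, abs_of_pos (inv_pos.2 hl), Real.mul_rpow (inv_pos.2 hl).le (abs_nonneg _),
    Real.inv_rpow hl.le, Real.rpow_neg hl.le]
  have : l ^ (1 + 2 * s) ≠ 0 := (Real.rpow_pos_of_pos hl _).ne'
  rw [← mul_div_assoc, mul_div_mul_left _ _ (inv_ne_zero this)]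

theorem setIntegral_comp_inv_smul (F : ℝ × ℝ → ℝ) {l : ℝ} (hl : 0 < l) (A : Set (ℝ × ℝ)) :
    ∫ q in A, F (l⁻¹ • q) = l ^ 2 * ∫ q in {q | l • q ∈ A}, F q := by
  have h := Measure.setIntegral_comp_smul_of_pos (volume : Measure (ℝ × ℝ)) F A (inv_pos.2 hl)
  have h2 : l⁻¹ • A = {q | l • q ∈ A} := by
    ext q
    rw [mem_inv_smul_set_iff₀ hl.ne']
    rfl
  rw [h, h2, Module.finrank_prod, Module.finrank_self, smul_eq_mul, inv_pow, inv_inv]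

/-- Integrals over dilations of a set that exhaust `S`. -/
theorem tendsto_setIntegral_dilation {F : ℝ × ℝ → ℝ} {S A : Set (ℝ × ℝ)} (hF : IntegrableOn F S)
    (hS : MeasurableSet S) (hA : MeasurableSet A) (hin : ∀ q ∈ S, ∀ᶠ l in 𝓝[>] (0 : ℝ), l • q ∈ A)
    (hout : ∀ l : ℝ, 0 < l → ∀ q, l • q ∈ A → q ∈ S) :
    Tendsto (fun l : ℝ => ∫ q in {q | l • q ∈ A}, F q) (𝓝[>] 0) (𝓝 (∫ q in S, F q)) := by
  have hm : ∀ l : ℝ, MeasurableSet {q : ℝ × ℝ | l • q ∈ A} := fun l =>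
    (measurable_const_smul l) hA
  have hFi : Integrable (indicator S F) := hF.integrable_indicator hS
  -- Every point of `S` eventually lies in the dilated set, and the extension of `F` by zero
  -- dominates.
  have h := tendsto_integral_filter_of_dominated_convergence (μ := (volume : Measure (ℝ × ℝ)))
    (F := fun l : ℝ => indicator {q | l • q ∈ A} (indicator S F)) (f := indicator S F)
    (l := 𝓝[>] (0 : ℝ)) (fun q => ‖indicator S F q‖)
    (.of_forall fun l => hFi.aestronglyMeasurable.indicator (hm l))
    (.of_forall fun l => .of_forall fun q => norm_indicator_le_norm_self _ _) hFi.norm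
    (.of_forall fun q => ?_)
  · rw [integral_indicator hS] at h
    refine h.congr' ?_
    filter_upwards [self_mem_nhdsWithin] with l hl
    rw [integral_indicator (hm l)]
    refine setIntegral_congr_fun (hm l) fun q hq => ?_
    exact indicator_of_mem (hout l hl q hq) F
  · by_cases hq : q ∈ S
    · refine tendsto_const_nhds.congr' ?_
      filter_upwards [hin q hq] with l hl
      exact (indicator_of_mem (show q ∈ {q | l • q ∈ A} from hl) _).symm
    · have : ∀ l : ℝ, indicator {q | l • q ∈ A} (indicator S F) q = indicator S F q := fun l => by
        simp [indicator_of_notMem hq]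
      simp only [this, tendsto_const_nhds]

theorem eventually_smul_mem_Ioo (x : ℝ) : ∀ᶠ l in 𝓝[>] (0 : ℝ), l * x ∈ Ioo (-1 : ℝ) 1 := by
  have h : Tendsto (fun l : ℝ => l * x) (𝓝[>] 0) (𝓝 (0 * x)) :=
    (Continuous.tendsto (by fun_prop) 0).mono_left nhdsWithin_le_nhds
  rw [zero_mul] at h
  exact h (Ioo_mem_nhds (by norm_num) (by norm_num))

theorem integrableOn_of_lintegral_eq {F : ℝ × ℝ → ℝ} {S : Set (ℝ × ℝ)} (hS : MeasurableSet S)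
    (hF : Measurable F) (h0 : ∀ q ∈ S, 0 ≤ F q) {c : ℝ} (hc : 0 ≤ c)
    (h : ∫⁻ q in S, ENNReal.ofReal (F q) = ENNReal.ofReal c) :
    IntegrableOn F S ∧ ∫ q in S, F q = c := by
  have h0' : 0 ≤ᵐ[volume.restrict S] F := (ae_restrict_iff' hS).2 (.of_forall h0)
  constructor
  · refine ⟨hF.aestronglyMeasurable, ?_⟩
    rw [hasFiniteIntegral_iff_ofReal h0', h]
    exact ENNReal.ofReal_lt_top
  · rw [integral_eq_lintegral_of_nonneg_ae h0' hF.aestronglyMeasurable, h, ENNReal.toReal_ofReal hc]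

theorem integrable_gagliardoIntegrand_ramp {s : ℝ} (hs : 1 / 2 < s) (hs1 : s < 1) :
    Integrable (gagliardoIntegrand s (ramp 1)) ∧
      ∫ q, gagliardoIntegrand s (ramp 1) q = dConst s * spectralEnergy s := by
  have h := lintegral_gagliardoIntegrand_ramp hs hs1
  rw [← setLIntegral_univ] at h
  have h2 := integrableOn_of_lintegral_eq .univ
    (measurable_gagliardoIntegrand s (continuous_ramp 1).measurable)
    (fun q _ => gagliardoIntegrand_nonneg s _ q)
    (mul_nonneg (dConst_pos (by linarith) hs1).le (spectralEnergy_pos hs hs1).le) h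
  rwa [integrableOn_univ, setIntegral_univ] at h2

theorem memHs_ramp {s : ℝ} (hs : 1 / 2 < s) (hs1 : s < 1) {l : ℝ} (hl : 0 < l) :
    MemHs s (ramp l) := by
  refine ⟨.of_bound (continuous_ramp l).aestronglyMeasurable 1 (.of_forall (abs_ramp_le l)), ?_⟩
  have h := ((integrable_gagliardoIntegrand_ramp hs hs1).1.comp_smul
    (inv_ne_zero hl.ne')).const_mul (l ^ (-(1 + 2 * s)))
  rw [← funext (gagliardoIntegrand_ramp s hl)] at h
  exact h.integrableOn

/-- The kernel contributes `Λ^{-(1+2s)}` and the area `Λ²`, in total `Λ^a`. What remains is the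
integral for the unit ramp over squares that fill the plane. -/
theorem tendsto_gagliardoSq {a s : ℝ} (ha0 : a < 0) (hs : s = (1 - a) / 2) (hs2 : 1 / 2 < s)
    (hs1 : s < 1) :
    Tendsto (fun ε => ε ^ (1 - a) * gagliardoSq s (layerProfile a ε)) (𝓝[>] 0)
      (𝓝 (dConst s * spectralEnergy s)) := by
  obtain ⟨hi, hval⟩ := integrable_gagliardoIntegrand_ramp hs2 hs1
  have h := (tendsto_setIntegral_dilation (A := Ioo (-1 : ℝ) 1 ×ˢ Ioo (-1 : ℝ) 1)
    (integrableOn_univ.2 hi) .univ (measurableSet_Ioo.prod measurableSet_Ioo)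
    (fun q _ => ((eventually_smul_mem_Ioo q.1).and (eventually_smul_mem_Ioo q.2)).mono
      fun l hl => ⟨hl.1, hl.2⟩) (fun _ _ _ _ => mem_univ _)).comp (tendsto_layerWidth ha0)
  rw [setIntegral_univ, hval] at h
  refine h.congr' ?_
  filter_upwards [self_mem_nhdsWithin] with ε hε
  have hl := layerWidth_pos a hε
  have e : gagliardoSq s (layerProfile a ε) = layerWidth a ε ^ a *
      ∫ q in {q : ℝ × ℝ | layerWidth a ε • q ∈ Ioo (-1 : ℝ) 1 ×ˢ Ioo (-1 : ℝ) 1},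
        gagliardoIntegrand s (ramp 1) q := by
    have e1 : gagliardoSq s (layerProfile a ε) = ∫ q in Ioo (-1 : ℝ) 1 ×ˢ Ioo (-1 : ℝ) 1,
        layerWidth a ε ^ (-(1 + 2 * s)) *
          gagliardoIntegrand s (ramp 1) ((layerWidth a ε)⁻¹ • q) := by
      rw [← funext (gagliardoIntegrand_ramp s hl)]
      rfl
    rw [e1, integral_const_mul, setIntegral_comp_inv_smul _ hl, ← mul_assoc, ← Real.rpow_natCast,
      ← Real.rpow_add hl]
    congr 2
    rw [hs]
    push_cast
    ring
  rw [e, ← mul_assoc, rpow_mul_layerWidth_rpow ha0 hε, one_mul, Function.comp_apply]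

/-! ### Energy limits and the choice of kernels -/

/-- Admissible kernels: measurable, with all moments, and of mass one. -/
structure ExtensionKernel (K : ℝ → ℝ) : Prop where
  measurable : Measurable K
  hasMoments : HasMoments K
  integral_eq_one : ∫ z, K z = 1

/-- The rescaled energy of the kernel extension of `layerProfile a ε`. -/
noncomputable def scaledEnergy (a : ℝ) (K : ℝ → ℝ) (ε : ℝ) : ℝ :=
  ε ^ (1 - a) * weightedEnergy a (kernelExt K (rampDeriv (layerWidth a ε)))
    (fun p => -kernelExt (fun z => z * K z) (rampDeriv (layerWidth a ε)) p)

/-- The kernel depends on `ψ` but not on `ε`. After rescaling, only the domain varies, and the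
dilated rectangles fill the half-plane, where the energy is known exactly. -/
theorem SmoothProfile.exists_tendsto_scaledEnergy {a s : ℝ} (ha : -1 < a) (ha0 : a < 0)
    (hs : s = (1 - a) / 2) {ψ : ℝ → ℝ} (h : SmoothProfile ψ) :
    ∃ K, ExtensionKernel K ∧ Tendsto (scaledEnergy a K) (𝓝[>] 0)
      (𝓝 (profileEnergy a ψ * spectralEnergy s)) := by
  have hs2 : 1 / 2 < s := by linarith
  have hs1 : s < 1 := by linarith
  obtain ⟨K, hKm, hK, hK1, hKP⟩ := h.exists_kernel
  refine ⟨K, ⟨hKm, hK, hK1⟩, ?_⟩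
  have hψc := h.contDiff.continuous
  have hψd := h.continuous_deriv
  have hKm' : Measurable fun z => z * K z := by fun_prop
  have hE := measurable_kernelExt hKm (measurable_rampDeriv 1)
  have hE' := measurable_kernelExt hKm' (measurable_rampDeriv 1)
  set H : ℝ × ℝ → ℝ := fun p => (kernelExt K (rampDeriv 1) p ^ 2 +
    (-kernelExt (fun z => z * K z) (rampDeriv 1) p) ^ 2) * p.2 ^ a with hH
  have hen := lintegral_energy_kernelExt hs hs2 hs1 hKm hK
    (P := fun t => ENNReal.ofReal (deriv ψ t ^ 2 + ψ t ^ 2)) (by fun_prop) hKP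
  have hprof : ∫⁻ t in Ioi 0, ENNReal.ofReal (deriv ψ t ^ 2 + ψ t ^ 2) * ENNReal.ofReal (t ^ a) =
      ENNReal.ofReal (profileEnergy a ψ) := by
    have hnn : ∀ t ∈ Ioi (0 : ℝ), 0 ≤ (deriv ψ t ^ 2 + ψ t ^ 2) * t ^ a := fun t ht => by
      have : 0 < t ^ a := Real.rpow_pos_of_pos ht a
      positivity
    rw [profileEnergy, ofReal_integral_eq_lintegral_ofReal (h.integrableOn ha)
      ((ae_restrict_iff' measurableSet_Ioi).2 (.of_forall hnn))]
    refine lintegral_congr fun t => ?_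
    rw [ENNReal.ofReal_mul (by positivity)]
  have hEnn : 0 ≤ profileEnergy a ψ := setIntegral_nonneg measurableSet_Ioi fun t ht => by
    have : 0 < t ^ a := Real.rpow_pos_of_pos ht a
    positivity
  rw [hprof, ← ENNReal.ofReal_mul hEnn] at hen
  have hSm : MeasurableSet ((univ : Set ℝ) ×ˢ Ioi (0 : ℝ)) := .prod .univ measurableSet_Ioi
  obtain ⟨hi, hval⟩ := integrableOn_of_lintegral_eq (F := H) hSm (by fun_prop)
    (fun q hq => by
      have : 0 < q.2 ^ a := Real.rpow_pos_of_pos hq.2 a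
      simp only [hH]
      positivity) (mul_nonneg hEnn (spectralEnergy_pos hs2 hs1).le) hen
  have hlim := (tendsto_setIntegral_dilation (A := Omega) hi hSm
    (measurableSet_Ioo.prod measurableSet_Ioo)
    (fun q hq => by
      filter_upwards [eventually_smul_mem_Ioo q.1, eventually_smul_mem_Ioo q.2,
        self_mem_nhdsWithin] with l h1 h2 h3
      exact ⟨h1, mul_pos h3 hq.2, h2.2⟩)
    (fun l hl q hq => ⟨mem_univ _, pos_of_mul_pos_right hq.2.1 hl.le⟩)).comp
    (tendsto_layerWidth ha0)
  rw [hval] at hlim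
  refine hlim.congr' ?_
  filter_upwards [self_mem_nhdsWithin] with ε hε
  have hl := layerWidth_pos a hε
  set l := layerWidth a ε with hldef
  have e : weightedEnergy a (kernelExt K (rampDeriv l))
      (fun p => -kernelExt (fun z => z * K z) (rampDeriv l) p) =
      l ^ a * ∫ q in {q : ℝ × ℝ | l • q ∈ Omega}, H q := by
    have e1 : weightedEnergy a (kernelExt K (rampDeriv l))
      (fun p => -kernelExt (fun z => z * K z) (rampDeriv l) p) =
        ∫ p in Omega, l ^ (a - 2) * H (l⁻¹ • p) := by
      refine setIntegral_congr_fun (measurableSet_Ioo.prod measurableSet_Ioo) fun p hp => ?_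
      have hp2 : 0 < p.2 := hp.2.1
      simp only [hH, kernelExt_rampDeriv _ hl p, Prod.smul_snd, smul_eq_mul]
      rw [Real.mul_rpow (inv_pos.2 hl).le hp2.le, Real.inv_rpow hl.le, Real.rpow_sub hl,
        Real.rpow_two]
      have : l ^ a ≠ 0 := (Real.rpow_pos_of_pos hl _).ne'
      field_simp
    rw [e1, integral_const_mul, setIntegral_comp_inv_smul _ hl, ← mul_assoc, ← Real.rpow_natCast,
      ← Real.rpow_add hl]
    congr 2
    push_cast
    ring
  rw [scaledEnergy, ← hldef, e, ← mul_assoc, rpow_mul_layerWidth_rpow ha0 hε, one_mul,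
    Function.comp_apply]

/-- Diagonal selection: if values arbitrarily close to `L` are eventually attained by members of a
family, then some choice of members converges to `L`. -/
theorem exists_diagonal {ι : Type*} [Nonempty ι] {W : ι → ℝ → ℝ} {L : ℝ}
    (h : ∀ η > 0, ∃ k, ∀ᶠ ε in 𝓝[>] (0 : ℝ), |W k ε - L| < η) :
    ∃ κ : ℝ → ι, Tendsto (fun ε => W (κ ε) ε) (𝓝[>] 0) (𝓝 L) := by
  -- For each `ε` a member within `ε` of the best possible distance to `L` is chosen. No rate is
  -- needed in the hypothesis, since any fixed member bounds the infimum from above.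
  have hex : ∀ ε : ℝ, ∃ k, 0 < ε → |W k ε - L| < (⨅ k, |W k ε - L|) + ε := fun ε => by
    by_cases hε : 0 < ε
    · obtain ⟨k, hk⟩ := exists_lt_of_ciInf_lt (lt_add_of_pos_right (⨅ k, |W k ε - L|) hε)
      exact ⟨k, fun _ => hk⟩
    · exact ⟨Classical.arbitrary ι, fun h => absurd h hε⟩
  choose κ hκ using hex
  refine ⟨κ, Metric.tendsto_nhds.2 fun η hη => ?_⟩
  obtain ⟨k, hk⟩ := h (η / 2) (half_pos hη)
  filter_upwards [hk, Ioo_mem_nhdsGT (half_pos hη)] with ε h1 h2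
  rw [Real.dist_eq]
  have h3 : (⨅ k, |W k ε - L|) ≤ |W k ε - L| :=
    ciInf_le ⟨0, by rintro _ ⟨j, rfl⟩; exact abs_nonneg _⟩ k
  linarith [hκ ε h2.1, h2.2]

theorem exists_kernels_tendsto_scaledEnergy {a s : ℝ} (ha : -1 < a) (ha0 : a < 0)
    (hs : s = (1 - a) / 2) :
    ∃ κ : ℝ → ℝ → ℝ, (∀ ε, ExtensionKernel (κ ε)) ∧
      Tendsto (fun ε => scaledEnergy a (κ ε) ε) (𝓝[>] 0)
        (𝓝 (profileMin s * spectralEnergy s)) := by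
  have hJ := spectralEnergy_pos (s := s) (by linarith) (by linarith)
  have key : ∀ η > 0, ∃ k : {K : ℝ → ℝ // ExtensionKernel K}, ∀ᶠ ε in 𝓝[>] (0 : ℝ),
      |scaledEnergy a k ε - profileMin s * spectralEnergy s| < η := fun η hη => by
    obtain ⟨ψ, hψ, hge, hlt⟩ := exists_smoothProfile_energy_lt ha ha0
      (by linarith : 1 - 2 * s = a) (div_pos hη hJ)
    obtain ⟨K, hK, hlim⟩ := hψ.exists_tendsto_scaledEnergy ha ha0 hs
    refine ⟨⟨K, hK⟩, (hlim.sub_const _).abs.eventually_lt_const ?_⟩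
    -- The profile is taken within `η / J` of the minimum, so the limit energy is within `η` of `e_s
    -- J`.
    rw [← sub_mul, abs_of_nonneg (mul_nonneg (sub_nonneg.2 hge) hJ.le), ← lt_div_iff₀ hJ]
    linarith
  have : Nonempty {K : ℝ → ℝ // ExtensionKernel K} := ⟨(key 1 one_pos).choose⟩
  obtain ⟨κ, hκ⟩ := exists_diagonal key
  exact ⟨fun ε => κ ε, fun ε => (κ ε).2, hκ⟩

end FractionalTrace

/-! ### Asymptotic optimality -/

theorem proposition5p7 (a s : ℝ) (ha : -1 < a) (ha0 : a < 0) (hs : s = (1 - a) / 2) :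
    ∃ (u gx gy : ℝ → ℝ × ℝ → ℝ) (R : ℝ → ℝ),
      (∀ ε : ℝ, 0 < ε →
        FractionalTrace.MemW12 a (u ε) (gx ε) (gy ε) ∧
        FractionalTrace.MemHs s (FractionalTrace.layerProfile a ε) ∧
        FractionalTrace.IsTrace a (u ε) (gx ε) (gy ε) (FractionalTrace.layerProfile a ε) ∧
        ε ^ (1 - a) * FractionalTrace.weightedEnergy a (gx ε) (gy ε) =
          (FractionalTrace.DConst s)⁻¹ * ε ^ (1 - a) *
            FractionalTrace.gagliardoSq s (FractionalTrace.layerProfile a ε) + R ε) ∧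
      Tendsto R (𝓝[>] 0) (𝓝 0) ∧
      R =o[𝓝[>] 0]
        (fun ε => ε ^ (1 - a) * FractionalTrace.weightedEnergy a (gx ε) (gy ε)) ∧
      R =o[𝓝[>] 0]
        (fun ε => (FractionalTrace.DConst s)⁻¹ * ε ^ (1 - a) *
          FractionalTrace.gagliardoSq s (FractionalTrace.layerProfile a ε)) ∧
      Tendsto (fun ε => FractionalTrace.gagliardoSq s (FractionalTrace.layerProfile a ε) /
          FractionalTrace.weightedEnergy a (gx ε) (gy ε)) (𝓝[>] 0)
        (𝓝 (FractionalTrace.DConst s)) := by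
  have hs2 : 1 / 2 < s := by linarith
  have hs1 : s < 1 := by linarith
  obtain ⟨κ, hκ, hX⟩ := FractionalTrace.exists_kernels_tendsto_scaledEnergy ha ha0 hs
  have hY := FractionalTrace.tendsto_gagliardoSq ha0 hs hs2 hs1
  have hJ := FractionalTrace.spectralEnergy_pos hs2 hs1
  have hd := FractionalTrace.dConst_pos (by linarith : 0 < s) hs1
  have he := FractionalTrace.profileMin_pos hs2 hs1
  set J := FractionalTrace.spectralEnergy s
  have hL : FractionalTrace.profileMin s * J ≠ 0 := (mul_pos he hJ).ne'
  have hZ : Tendsto (fun ε => (FractionalTrace.DConst s)⁻¹ * ε ^ (1 - a) *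
      FractionalTrace.gagliardoSq s (FractionalTrace.layerProfile a ε)) (𝓝[>] 0)
      (𝓝 (FractionalTrace.profileMin s * J)) := by
    have h := hY.const_mul (FractionalTrace.DConst s)⁻¹
    have e : (FractionalTrace.DConst s)⁻¹ * (FractionalTrace.dConst s * J) =
        FractionalTrace.profileMin s * J := by
      rw [FractionalTrace.DConst]
      field_simp
    rw [e] at h
    exact h.congr fun ε => (mul_assoc _ _ _).symm
  set X : ℝ → ℝ := fun ε => FractionalTrace.scaledEnergy a (κ ε) ε with hXdef
  set Z : ℝ → ℝ := fun ε => (FractionalTrace.DConst s)⁻¹ * ε ^ (1 - a) *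
      FractionalTrace.gagliardoSq s (FractionalTrace.layerProfile a ε) with hZdef
  have hR : Tendsto (fun ε => X ε - Z ε) (𝓝[>] 0) (𝓝 0) := by simpa using hX.sub hZ
  -- A remainder tending to 0 is of lower order than anything with a nonzero limit; both sides of
  -- the identity have the limit `e_s J`.
  have hlittle : ∀ {Y : ℝ → ℝ}, Tendsto Y (𝓝[>] 0) (𝓝 (FractionalTrace.profileMin s * J)) →
      (fun ε => X ε - Z ε) =o[𝓝[>] 0] Y := fun {Y} h => by
    have hdiv := hR.div h hL
    rw [zero_div] at hdiv
    refine (isLittleO_iff_tendsto' ?_).2 hdiv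
    filter_upwards [h.eventually_ne hL] with ε hε h0 using absurd h0 hε
  refine ⟨fun ε => FractionalTrace.kernelExt (κ ε) (FractionalTrace.layerProfile a ε),
    fun ε => FractionalTrace.kernelExt (κ ε)
      (FractionalTrace.rampDeriv (FractionalTrace.layerWidth a ε)),
    fun ε p => -FractionalTrace.kernelExt (fun z => z * κ ε z)
      (FractionalTrace.rampDeriv (FractionalTrace.layerWidth a ε)) p,
    fun ε => X ε - Z ε, fun ε hε => ?_, hR, hlittle hX, hlittle hZ, ?_⟩
  · have hl := FractionalTrace.layerWidth_pos a hε
    obtain ⟨h1, h2⟩ := (FractionalTrace.smoothLimit_ramp hl).kernelExt_approx ha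
      (hκ ε).measurable (hκ ε).hasMoments (hκ ε).integral_eq_one
    exact ⟨h1, FractionalTrace.memHs_ramp hs2 hs1 hl, h2, (add_sub_cancel (Z ε) (X ε)).symm⟩
  · have h := hY.div hX hL
    -- The common factor `J` cancels from the ratio of the limits, leaving `d_s / e_s`.
    rw [mul_div_mul_right _ _ hJ.ne'] at h
    refine h.congr' ?_
    filter_upwards [self_mem_nhdsWithin] with ε hε
    exact mul_div_mul_left _ _ (Real.rpow_pos_of_pos hε _).ne'
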